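/- Let $[n]=\{1,\dots,n\}$. In an edge-Markovian random graph process $G=(G_t)_{t\ge 0}$ on the vertex set $[n]$ each of the $\binom n2$ potential edges (unordered pairs of distinct vertices) is at each time absent (state $0$) or present (state $1$), and the whole graph evolves as a Markov chain in which, at each step, all potential edges move independently of one another according to the same transition matrix $$P_n=\begin{pmatrix}1-f(n)&f(n)\\ 1-g(n)&g(n)\end{pmatrix},$$ so that $f(n)$ is the probability that an absent edge is present at the next time and $g(n)$ the probability that a present edge is again present at the next time. The law of the initial graph $G_0$ is arbitrary (in particular it may be the stationary one). Assume that for all sufficiently large $n$ we have $f(n),g(n)\in[0,1]$, that on this range of $n$ the functions $f$ and $g$ are (not necessarily strictly) decreasing, that $f(n)$ and $g(n)$ converge to the same constant $\gamma\ge 0$ as $n\to\infty$, that there are constants $M,\alpha>0$ with $|g(n)-f(n)|\le M/n^{\alpha}$ for all sufficiently large $n$, and that there is a constant $a>0$ such that, for all sufficiently large $n$, the stationary distribution $\pi=(\pi(0),\pi(1))$ of $P_n$ satisfies $\pi(1)=a/n$. A rumor starts at a single informed vertex. In round $t+1$ ($t\ge0$) each vertex that the protocol makes active contacts a uniformly random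 neighbor in $G_t$ (nobody, if it is isolated in $G_t$), all contacts being independent given the graph process. In the Pull protocol the uninformed vertices are active, and such a vertex becomes informed if the vertex that it contacts was informed before the round. In the Push-Pull protocol all vertices are active, and an uninformed vertex becomes informed if the vertex that it contacts was informed before the round, or if it is contacted by a vertex that was informed before the round. The completion time $T_n$ is the number of rounds until all vertices are informed ($\infty$ if this never happens). Then: 1. the completion time of the Pull protocol over $G$ is $O(\log n)$ with high probability; 2. the completion time of the Push-Pull protocol over $G$ is $O(\log n)$ with high probability. Here "$T_n$ is $O(\log n)$ with high probability" means that there are constants $C,c>0$ and $N$, which do not depend on $n$, on the initial law of the graph or on the initially informed vertex, such that $\mathbb P(T_n>C\log n)\le n^{-c}$ for all $n\ge N$. -/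

import Mathlib

open scoped ENNReal

universe u

noncomputable section

namespace RumorSpreading

/-- The transition matrix of a single edge, with state `0` (absent) and state `1` (present):
`f = P(1|0)` and `g = P(1|1)`. -/
def edgeMatrix (f g : ℝ) : Matrix (Fin 2) (Fin 2) ℝ :=
  !![1 - f, f; 1 - g, g]

/-- `π` is a stationary probability distribution of the stochastic matrix `P`. -/
def IsStationaryDistribution (P : Matrix (Fin 2) (Fin 2) ℝ) (π : Fin 2 → ℝ) : Prop :=
  π ∈ stdSimplex ℝ (Fin 2) ∧ Matrix.vecMul π P = π

open Classical in
/-- The state of the potential edge `e` in the graph `G`: `1` if present, `0` if absent. -/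
def edgeState {n : ℕ} (G : SimpleGraph (Fin n)) (e : Sym2 (Fin n)) : Fin 2 :=
  if e ∈ G.edgeSet then 1 else 0

open Classical in
/-- One-step transition probability from the graph `G` to the graph `H` when all potential edges
(the unordered pairs of distinct vertices, i.e. the edges of the complete graph) move independently
according to the matrix `P`. -/
def graphTransition {n : ℕ} (P : Matrix (Fin 2) (Fin 2) ℝ) (G H : SimpleGraph (Fin n)) : ℝ :=
  ∏ e ∈ (⊤ : SimpleGraph (Fin n)).edgeFinset, P (edgeState G e) (edgeState H e)

/-- `G` is an edge-Markovian random graph process with edge transition matrix `P`, with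
arbitrary initial law: a Markov chain on the graphs with vertex set `Fin n` whose transition
probabilities are given by `graphTransition P`. -/
structure IsEdgeMarkovian {n : ℕ} {Ω : Type u} [MeasurableSpace Ω]
    (μ : MeasureTheory.Measure Ω) (P : Matrix (Fin 2) (Fin 2) ℝ)
    (G : ℕ → Ω → SimpleGraph (Fin n)) : Prop where
  measurableSet_eq : ∀ (t : ℕ) (γ : SimpleGraph (Fin n)), MeasurableSet {ω | G t ω = γ}
  law : ∀ (t : ℕ) (γ : ℕ → SimpleGraph (Fin n)),
    μ.real {ω | ∀ s ≤ t, G s ω = γ s} =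
      μ.real {ω | G 0 ω = γ 0} * ∏ s ∈ Finset.range t, graphTransition P (γ s) (γ (s + 1))

open Classical in
/-- The law of the neighbour that the vertex `v` contacts in the graph `G`: a uniformly random
neighbour of `v` (`some w`), or nobody (`none`) if `v` is isolated. -/
def contactProb {n : ℕ} (G : SimpleGraph (Fin n)) (v : Fin n) : Option (Fin n) → ℝ
  | none => if G.degree v = 0 then 1 else 0
  | some w => if G.Adj v w then 1 / (G.degree v : ℝ) else 0

/-- `χ t ω v` is the vertex contacted by `v` in round `t`. Given the graph process, the contacts of
all vertices in all rounds are independent, and the one of `v` in round `t` is a uniformly random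
neighbour of `v` in the graph `G t`. The contact of a vertex that the protocol keeps inactive in a
round is simply not used. -/
structure IsUniformContacts {n : ℕ} {Ω : Type u} [MeasurableSpace Ω]
    (μ : MeasureTheory.Measure Ω) (G : ℕ → Ω → SimpleGraph (Fin n))
    (χ : ℕ → Ω → Fin n → Option (Fin n)) : Prop where
  measurableSet_eq : ∀ (t : ℕ) (c : Fin n → Option (Fin n)), MeasurableSet {ω | χ t ω = c}
  law : ∀ (t : ℕ) (γ : ℕ → SimpleGraph (Fin n)) (c : ℕ → Fin n → Option (Fin n)),
    μ.real {ω | ∀ s ≤ t, G s ω = γ s ∧ χ s ω = c s} =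
      μ.real {ω | ∀ s ≤ t, G s ω = γ s} *
        ∏ s ∈ Finset.range (t + 1), ∏ v, contactProb (γ s) v (c s v)

/-- A protocol, given by the effect of one synchronous round: from the contacts of the round and the
set of vertices informed before it, it produces the set of vertices informed after it. -/
def Protocol : Type :=
  ∀ n : ℕ, (Fin n → Option (Fin n)) → Finset (Fin n) → Finset (Fin n)

/-- Pull: an uninformed vertex becomes informed if the neighbour it contacts is informed. -/
def pull : Protocol := fun _ c I =>
  I ∪ Finset.univ.filter (fun v => ∃ w ∈ I, c v = some w)

/-- Push-Pull: an uninformed vertex becomes informed if the neighbour it contacts is informed (pull)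
or if some informed vertex contacts it (push). -/
def pushPull : Protocol := fun _ c I =>
  I ∪ Finset.univ.filter (fun v => (∃ w ∈ I, c v = some w) ∨ ∃ w ∈ I, c w = some v)

/-- The set of informed vertices after `t` rounds, starting with the single informed vertex `v₀`. -/
def informed (proto : Protocol) {n : ℕ} {Ω : Type u} (χ : ℕ → Ω → Fin n → Option (Fin n))
    (v₀ : Fin n) (ω : Ω) : ℕ → Finset (Fin n)
  | 0 => {v₀}
  | t + 1 => proto n (χ t ω) (informed proto χ v₀ ω t)

/-- The number of rounds until all vertices are informed (`⊤` if this never happens). -/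
def completionTime (proto : Protocol) {n : ℕ} {Ω : Type u} (χ : ℕ → Ω → Fin n → Option (Fin n))
    (v₀ : Fin n) (ω : Ω) : ℕ∞ :=
  sInf {k : ℕ∞ | ∃ t : ℕ, k = t ∧ informed proto χ v₀ ω t = Finset.univ}

/-- The completion time of the protocol over edge-Markovian random graphs on `n` vertices with edge
transition matrix `P n` is `O(r n)` with high probability: for some constants `C, c > 0` and all
large `n`, the probability that it exceeds `C * r n` is at most `n ^ (-c)`, whatever the initial law
of the graph, the initially informed vertex and the probability space carrying the process. -/
def CompletesInBigOWhp (proto : Protocol) (P : ℕ → Matrix (Fin 2) (Fin 2) ℝ) (r : ℕ → ℝ) : Prop :=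
  ∃ C : ℝ, 0 < C ∧ ∃ c : ℝ, 0 < c ∧ ∃ N : ℕ, ∀ n : ℕ, N ≤ n →
    ∀ (Ω : Type u) [MeasurableSpace Ω] (μ : MeasureTheory.Measure Ω)
      [MeasureTheory.IsProbabilityMeasure μ]
      (G : ℕ → Ω → SimpleGraph (Fin n)) (χ : ℕ → Ω → Fin n → Option (Fin n)) (v₀ : Fin n),
      IsEdgeMarkovian μ (P n) G → IsUniformContacts μ G χ →
        μ {ω | ENNReal.ofReal (C * r n) < (completionTime proto χ v₀ ω : ℝ≥0∞)} ≤
          ENNReal.ofReal ((n : ℝ) ^ (-c))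

end RumorSpreading

end

/-! On a common set of contacts, pull never informs more vertices than push-pull, so only pull needs
proof. Stationarity gives `f n * n = a * (1 - (g n - f n))`, which is of order `a`. Hence `g n ≤ f n
+ M / n ^ α` is at most `n ^ (-β)` for some `β > 0`: edges are sparse and are forgotten quickly.

The proof follows the potential `n / |I| - 1` of the informed set `I`. A vertex whose only neighbour
is informed pulls the rumor with certainty, so counting such vertices gives growth that no longer
involves the random contacts (`stepMean_le_graphMean`). Only pairs non-adjacent in the current graph
are counted: each of their edges appears with probability exactly `f`, independently, so the count
has a mean of order `min(|I|, n - |I|)` and a controlled second moment. If all current degrees are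
at most `D`, of order `log n`, the mean potential therefore shrinks by a factor `1 - δ`, with `δ`
independent of `n` (`stepMean_potential_le`).

Large degrees are rare after a bounded number `k` of steps, whatever the initial graph:
`integral_pow_degree_le` bounds the mean of `2 ^ degree` by a constant once `g ^ k * n ≤ 1`. Bad
graphs thus add only a small error to the recursion for the mean potential. As the potential is at
least `1 / n` while a vertex is uninformed, order `log n` steps and Markov's inequality suffice
(`measureReal_informed_ne_univ_le`). -/

namespace RumorSpreading

open MeasureTheory

/-! ### Deterministic properties of the protocols -/

/-- The informed set after `t` rounds depends only on the contacts of the first `t` rounds. -/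
theorem informed_congr (proto : Protocol) {n : ℕ} {Ω Ω' : Type*}
    {χ : ℕ → Ω → Fin n → Option (Fin n)} {χ' : ℕ → Ω' → Fin n → Option (Fin n)} (v₀ : Fin n)
    {ω : Ω} {ω' : Ω'} {t : ℕ} (h : ∀ s < t, χ s ω = χ' s ω') :
    informed proto χ v₀ ω t = informed proto χ' v₀ ω' t := by
  induction t with
  | zero => rfl
  | succ t ih =>
    simp only [informed]
    rw [ih fun s hs => h s (by omega), h t (by omega)]

/-- Allowing different informed sets on the two sides makes the comparison survive induction over
the rounds. -/
theorem pull_subset_pushPull {n : ℕ} (c : Fin n → Option (Fin n)) {I J : Finset (Fin n)}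
    (h : I ⊆ J) : pull n c I ⊆ pushPull n c J := by
  intro v hv
  simp only [pull, pushPull, Finset.mem_union, Finset.mem_filter, Finset.mem_univ,
    true_and] at hv ⊢
  rcases hv with hv | ⟨w, hw, hc⟩
  · exact Or.inl (h hv)
  · exact Or.inr (Or.inl ⟨w, h hw, hc⟩)

theorem informed_pull_subset_pushPull {n : ℕ} {Ω : Type*}
    (χ : ℕ → Ω → Fin n → Option (Fin n)) (v₀ : Fin n) (ω : Ω) (t : ℕ) :
    informed pull χ v₀ ω t ⊆ informed pushPull χ v₀ ω t := by
  induction t with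
  | zero => exact subset_rfl
  | succ t ih => exact pull_subset_pushPull _ ih

theorem subset_pull {n : ℕ} (c : Fin n → Option (Fin n)) (I : Finset (Fin n)) :
    I ⊆ pull n c I := Finset.subset_union_left

theorem informed_pull_nonempty {n : ℕ} {Ω : Type*}
    (χ : ℕ → Ω → Fin n → Option (Fin n)) (v₀ : Fin n) (ω : Ω) (t : ℕ) :
    (informed pull χ v₀ ω t).Nonempty := by
  induction t with
  | zero => exact ⟨v₀, Finset.mem_singleton_self v₀⟩
  | succ t ih => exact ih.mono (subset_pull _ _)

theorem completionTime_le {proto : Protocol} {n : ℕ} {Ω : Type*}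
    {χ : ℕ → Ω → Fin n → Option (Fin n)} {v₀ : Fin n} {ω : Ω} {t : ℕ}
    (h : informed proto χ v₀ ω t = Finset.univ) : completionTime proto χ v₀ ω ≤ t :=
  sInf_le ⟨t, rfl, h⟩

/-! ### Random variables with finitely many values -/

section FiniteValued

variable {Ω : Type*} [MeasurableSpace Ω] {μ : Measure Ω} [IsFiniteMeasure μ] {T : Type*}
  [Fintype T] {Y : Ω → T}

theorem measurable_comp_of_finite (hY : ∀ y, MeasurableSet {ω | Y ω = y}) {β : Type*}
    [MeasurableSpace β] (φ : T → β) : Measurable fun ω => φ (Y ω) := by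
  let _ : MeasurableSpace T := ⊤
  have h : Measurable Y := measurable_to_countable' fun y => hY y
  exact (measurable_from_top (f := φ)).comp h

theorem integrable_comp_of_finite (hY : ∀ y, MeasurableSet {ω | Y ω = y}) (φ : T → ℝ) :
    Integrable (fun ω => φ (Y ω)) μ := by
  refine Integrable.of_bound (measurable_comp_of_finite hY φ).aestronglyMeasurable
    (∑ y, ‖φ y‖) (Filter.Eventually.of_forall fun ω => ?_)
  exact Finset.single_le_sum (f := fun y => ‖φ y‖) (fun _ _ => norm_nonneg _)
    (Finset.mem_univ (Y ω))

theorem integral_comp_of_finite (hY : ∀ y, MeasurableSet {ω | Y ω = y}) (φ : T → ℝ) :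
    ∫ ω, φ (Y ω) ∂μ = ∑ y, μ.real {ω | Y ω = y} * φ y := by
  classical
  have h : ∀ ω, φ (Y ω) = ∑ y, Set.indicator {ω | Y ω = y} (fun _ => φ y) ω := by
    intro ω
    simp [Set.indicator_apply]
  simp_rw [h]
  rw [integral_finsetSum _ fun y _ => (integrable_const (φ y)).indicator (hY y)]
  refine Finset.sum_congr rfl fun y _ => ?_
  rw [integral_indicator (hY y), setIntegral_const, smul_eq_mul]

end FiniteValued

/-! ### The Markov chain of graphs and informed sets -/

/-- The mean of `F` after one more step of the graph and one round of the pull protocol, starting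
from the graph `H` and the informed set `I`. -/
noncomputable def stepMean {n : ℕ} (P : Matrix (Fin 2) (Fin 2) ℝ)
    (F : SimpleGraph (Fin n) → Finset (Fin n) → ℝ) (H : SimpleGraph (Fin n))
    (I : Finset (Fin n)) : ℝ :=
  ∑ H', graphTransition P H H' *
    ∑ c : Fin n → Option (Fin n), (∏ v, contactProb H' v (c v)) * F H' (pull n c I)

/-- The graphs and contacts of the rounds `0, …, t`. -/
def history {n : ℕ} {Ω : Type u} (G : ℕ → Ω → SimpleGraph (Fin n))
    (χ : ℕ → Ω → Fin n → Option (Fin n)) (t : ℕ)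
    (ω : Ω) (i : Fin (t + 1)) : SimpleGraph (Fin n) × (Fin n → Option (Fin n)) :=
  (G i ω, χ i ω)

/-- The laws are stated for sequences indexed by `ℕ`, histories for `Fin (t + 1)`. `Fin.ofNat`
extends a history periodically; its values beyond `t` are never read. -/
theorem history_eq_iff {n : ℕ} {Ω : Type u} {G : ℕ → Ω → SimpleGraph (Fin n)}
    {χ : ℕ → Ω → Fin n → Option (Fin n)} {t : ℕ} {ω : Ω}
    {h : Fin (t + 1) → SimpleGraph (Fin n) × (Fin n → Option (Fin n))} :
    history G χ t ω = h ↔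
      ∀ s ≤ t, G s ω = (h (Fin.ofNat (t + 1) s)).1 ∧ χ s ω = (h (Fin.ofNat (t + 1) s)).2 := by
  have key : ∀ i : Fin (t + 1), Fin.ofNat (t + 1) (i : ℕ) = i := fun i =>
    Fin.ext (Nat.mod_eq_of_lt i.isLt)
  constructor
  · rintro rfl s hs
    have : (Fin.ofNat (t + 1) s : ℕ) = s := Nat.mod_eq_of_lt (by omega)
    simp only [history, this, and_self]
  · intro H
    funext i
    have := H i (by omega)
    rw [key i] at this
    exact Prod.ext this.1 this.2

section MarkovChain

variable {n : ℕ} {Ω : Type u} [MeasurableSpace Ω] {μ : Measure Ω}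
  {P : Matrix (Fin 2) (Fin 2) ℝ} {G : ℕ → Ω → SimpleGraph (Fin n)}
  {χ : ℕ → Ω → Fin n → Option (Fin n)}

theorem measurableSet_history_eq (hG : IsEdgeMarkovian μ P G) (hχ : IsUniformContacts μ G χ)
    (t : ℕ) (h : Fin (t + 1) → SimpleGraph (Fin n) × (Fin n → Option (Fin n))) :
    MeasurableSet {ω | history G χ t ω = h} := by
  have : {ω | history G χ t ω = h} =
      ⋂ i : Fin (t + 1), {ω | G i ω = (h i).1} ∩ {ω | χ i ω = (h i).2} := by
    ext ω
    simp [history, funext_iff, Prod.ext_iff]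
  rw [this]
  exact MeasurableSet.iInter fun i =>
    (hG.measurableSet_eq i _).inter (hχ.measurableSet_eq i _)

/-- Graphs and contacts together form a Markov chain. -/
theorem measureReal_history_succ (hG : IsEdgeMarkovian μ P G) (hχ : IsUniformContacts μ G χ)
    (t : ℕ) (h : Fin (t + 1) → SimpleGraph (Fin n) × (Fin n → Option (Fin n)))
    (x : SimpleGraph (Fin n) × (Fin n → Option (Fin n))) :
    μ.real {ω | history G χ (t + 1) ω = Fin.snoc (α := fun _ => _) h x} =
      μ.real {ω | history G χ t ω = h} * (graphTransition P (h (Fin.last t)).1 x.1 *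
        ∏ v, contactProb x.1 v (x.2 v)) := by
  set y : ℕ → SimpleGraph (Fin n) × (Fin n → Option (Fin n)) := fun s =>
    (Fin.snoc (α := fun _ => SimpleGraph (Fin n) × (Fin n → Option (Fin n))) h x :
      Fin (t + 2) → _) (Fin.ofNat (t + 2) s) with hy
  have hyl : y (t + 1) = x := by
    have : Fin.ofNat (t + 2) (t + 1) = Fin.last (t + 1) :=
      Fin.ext (Nat.mod_eq_of_lt (by omega))
    simp only [hy, this, Fin.snoc_last]
  have hys : ∀ s ≤ t, y s = h (Fin.ofNat (t + 1) s) := by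
    intro s hs
    have : Fin.ofNat (t + 2) s = Fin.castSucc (Fin.ofNat (t + 1) s) := by
      apply Fin.ext
      simp only [Fin.val_castSucc, Fin.val_ofNat]
      rw [Nat.mod_eq_of_lt (by omega), Nat.mod_eq_of_lt (by omega)]
    simp only [hy, this, Fin.snoc_castSucc]
  have hlast : Fin.ofNat (t + 1) t = Fin.last t := Fin.ext (Nat.mod_eq_of_lt (by omega))
  have e1 : {ω | history G χ (t + 1) ω = Fin.snoc (α := fun _ => _) h x} =
      {ω | ∀ s ≤ t + 1, G s ω = (y s).1 ∧ χ s ω = (y s).2} := by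
    ext ω
    exact history_eq_iff
  have e2 : {ω | history G χ t ω = h} = {ω | ∀ s ≤ t, G s ω = (y s).1 ∧ χ s ω = (y s).2} := by
    ext ω
    simp only [Set.mem_ofPred_eq]
    rw [history_eq_iff]
    exact forall₂_congr fun s hs => by rw [hys s hs]
  rw [e1, e2, hχ.law (t + 1) (fun s => (y s).1) (fun s => (y s).2),
    hχ.law t (fun s => (y s).1) (fun s => (y s).2), hG.law, hG.law,
    Finset.prod_range_succ _ (t + 1), Finset.prod_range_succ _ t, hyl, hys t le_rfl, hlast]
  ring

theorem measurableSet_graph_informed (hG : IsEdgeMarkovian μ P G) (hχ : IsUniformContacts μ G χ)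
    (v₀ : Fin n) (t : ℕ) (y : SimpleGraph (Fin n) × Finset (Fin n)) :
    MeasurableSet {ω | (G t ω, informed pull χ v₀ ω (t + 1)) = y} := by
  let S := SimpleGraph (Fin n) × (Fin n → Option (Fin n))
  let φ : (Fin (t + 1) → S) → SimpleGraph (Fin n) × Finset (Fin n) := fun h =>
    ((h (Fin.last t)).1,
      informed pull (fun s (h : Fin (t + 1) → S) => (h (Fin.ofNat (t + 1) s)).2) v₀ h (t + 1))
  have hφ : ∀ ω, (G t ω, informed pull χ v₀ ω (t + 1)) = φ (history G χ t ω) := fun ω =>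
    Prod.ext rfl (informed_congr _ _ fun s hs =>
      ((history_eq_iff (h := history G χ t ω)).1 rfl s (by omega)).2)
  let _ : MeasurableSpace (SimpleGraph (Fin n) × Finset (Fin n)) := ⊤
  have hm : Measurable fun ω => (G t ω, informed pull χ v₀ ω (t + 1)) := by
    rw [funext hφ]
    exact measurable_comp_of_finite (measurableSet_history_eq hG hχ t) φ
  have hy : MeasurableSet ({y} : Set (SimpleGraph (Fin n) × Finset (Fin n))) := trivial
  exact measurableSet_preimage hm hy

/-- One step of the chain formed by the graph and the set informed by pull. -/
theorem integral_graph_informed_succ [IsFiniteMeasure μ] (hG : IsEdgeMarkovian μ P G)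
    (hχ : IsUniformContacts μ G χ) (v₀ : Fin n)
    (F : SimpleGraph (Fin n) → Finset (Fin n) → ℝ) (t : ℕ) :
    ∫ ω, F (G (t + 1) ω) (informed pull χ v₀ ω (t + 2)) ∂μ =
      ∫ ω, stepMean P F (G t ω) (informed pull χ v₀ ω (t + 1)) ∂μ := by
  classical
  let S := SimpleGraph (Fin n) × (Fin n → Option (Fin n))
  let J : (Fin (t + 1) → S) → Finset (Fin n) := fun h =>
    informed pull (fun s (h : Fin (t + 1) → S) => (h (Fin.ofNat (t + 1) s)).2) v₀ h (t + 1)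
  have hJ : ∀ ω, informed pull χ v₀ ω (t + 1) = J (history G χ t ω) := fun ω =>
    informed_congr _ _ fun s hs =>
      ((history_eq_iff (h := history G χ t ω)).1 rfl s (by omega)).2
  have hR : ∫ ω, stepMean P F (G t ω) (informed pull χ v₀ ω (t + 1)) ∂μ =
      ∑ h, μ.real {ω | history G χ t ω = h} * stepMean P F (h (Fin.last t)).1 (J h) := by
    rw [← integral_comp_of_finite (measurableSet_history_eq hG hχ t)
      (fun h => stepMean P F (h (Fin.last t)).1 (J h))]
    simp_rw [hJ]
    rfl
  have hL : ∫ ω, F (G (t + 1) ω) (informed pull χ v₀ ω (t + 2)) ∂μ =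
      ∑ h : Fin (t + 2) → S, μ.real {ω | history G χ (t + 1) ω = h} *
        F (h (Fin.last (t + 1))).1
          (pull n (h (Fin.last (t + 1))).2 (J fun i => h i.castSucc)) := by
    rw [← integral_comp_of_finite (measurableSet_history_eq hG hχ (t + 1))
      (fun h => F (h (Fin.last (t + 1))).1
          (pull n (h (Fin.last (t + 1))).2 (J fun i => h i.castSucc)))]
    refine integral_congr_ae (Filter.Eventually.of_forall fun ω => ?_)
    change F (G (t + 1) ω) (pull n (χ (t + 1) ω) (informed pull χ v₀ ω (t + 1))) = _
    rw [hJ]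
    rfl
  -- A history up to `t + 1` is split into one up to `t` and a last entry; summing over that entry
  -- produces `stepMean`.
  rw [hL, hR, ← (Fin.snocEquiv fun _ : Fin (t + 2) => S).sum_comp, Fintype.sum_prod_type_right]
  refine Finset.sum_congr rfl fun h _ => ?_
  rw [stepMean, Finset.mul_sum, Fintype.sum_prod_type]
  refine Finset.sum_congr rfl fun H' _ => ?_
  rw [Finset.mul_sum, Finset.mul_sum]
  refine Finset.sum_congr rfl fun c _ => ?_
  have := measureReal_history_succ hG hχ t h (H', c)
  simp only [Fin.snocEquiv, Equiv.coe_fn_mk, Fin.snoc_last, Fin.snoc_castSucc]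
  rw [this]
  ring

end MarkovChain

/-! ### One step of the graph: independence of the edges -/

section EdgeProducts

variable {n : ℕ}

theorem edgeState_eq_one {G : SimpleGraph (Fin n)} {e : Sym2 (Fin n)} :
    edgeState G e = 1 ↔ e ∈ G.edgeSet := by
  simp [edgeState]

theorem edgeState_eq_zero {G : SimpleGraph (Fin n)} {e : Sym2 (Fin n)} :
    edgeState G e = 0 ↔ e ∉ G.edgeSet := by
  simp [edgeState]

open Classical in
/-- A sum over all graphs of a product over all potential edges factorizes. -/
theorem sum_prod_edgeState (ψ : Sym2 (Fin n) → Fin 2 → ℝ) :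
    ∑ G : SimpleGraph (Fin n), ∏ e ∈ (⊤ : SimpleGraph (Fin n)).edgeFinset, ψ e (edgeState G e) =
      ∏ e ∈ (⊤ : SimpleGraph (Fin n)).edgeFinset, ∑ s, ψ e s := by
  simp_rw [Fin.sum_univ_two, add_comm (ψ _ 0)]
  -- Expanding the product of binary sums gives a sum over sets of present edges, and these sets
  -- correspond to graphs.
  rw [Finset.prod_add]
  refine Finset.sum_nbij' (fun G => G.edgeFinset) (fun t => SimpleGraph.fromEdgeSet ↑t)
    (fun G _ => ?_) (fun _ _ => Finset.mem_univ _) (fun G _ => ?_) (fun t ht => ?_)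
    (fun G _ => ?_)
  · rw [Finset.mem_powerset]
    exact SimpleGraph.edgeFinset_mono le_top
  · simp
  · rw [Finset.mem_powerset] at ht
    ext e
    simp only [SimpleGraph.mem_edgeFinset, SimpleGraph.edgeSet_fromEdgeSet, Set.mem_sdiff,
      Finset.mem_coe, and_iff_left_iff_imp]
    intro he
    have := ht he
    simpa using this
  · rw [← Finset.prod_sdiff (SimpleGraph.edgeFinset_mono (le_top : G ≤ ⊤)), mul_comm]
    congr 1
    · refine Finset.prod_congr rfl fun e he => ?_
      rw [edgeState_eq_one.2 (SimpleGraph.mem_edgeFinset.1 he)]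
    · refine Finset.prod_congr rfl fun e he => ?_
      rw [edgeState_eq_zero.2 fun h => (Finset.mem_sdiff.1 he).2 (SimpleGraph.mem_edgeFinset.2 h)]

/-- The mean of `F` after one step of the graph chain started from `H`. -/
noncomputable def graphMean (P : Matrix (Fin 2) (Fin 2) ℝ) (H : SimpleGraph (Fin n))
    (F : SimpleGraph (Fin n) → ℝ) : ℝ :=
  ∑ H', graphTransition P H H' * F H'

open Classical in
theorem graphMean_eq_prod (P : Matrix (Fin 2) (Fin 2) ℝ) (H : SimpleGraph (Fin n))
    {F : SimpleGraph (Fin n) → ℝ} (h : Sym2 (Fin n) → Fin 2 → ℝ)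
    (hF : ∀ H', F H' =
      ∏ e ∈ (⊤ : SimpleGraph (Fin n)).edgeFinset, h e (edgeState H' e)) :
    graphMean P H F =
      ∏ e ∈ (⊤ : SimpleGraph (Fin n)).edgeFinset, ∑ s, P (edgeState H e) s * h e s := by
  simp_rw [graphMean, hF, graphTransition, ← Finset.prod_mul_distrib]
  exact sum_prod_edgeState fun e s => P (edgeState H e) s * h e s

variable {f g : ℝ} (H : SimpleGraph (Fin n))

theorem edgeMatrix_sum_row (i : Fin 2) : ∑ s, edgeMatrix f g i s = 1 := by
  fin_cases i <;> simp [edgeMatrix]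

theorem edgeMatrix_nonneg (hf : f ∈ Set.Icc (0 : ℝ) 1) (hg : g ∈ Set.Icc (0 : ℝ) 1)
    (i j : Fin 2) : 0 ≤ edgeMatrix f g i j := by
  have := hf.1; have := hf.2; have := hg.1; have := hg.2
  fin_cases i <;> fin_cases j <;> simp [edgeMatrix] <;> linarith

theorem graphTransition_nonneg (hf : f ∈ Set.Icc (0 : ℝ) 1) (hg : g ∈ Set.Icc (0 : ℝ) 1)
    (H' : SimpleGraph (Fin n)) : 0 ≤ graphTransition (edgeMatrix f g) H H' :=
  Finset.prod_nonneg fun _ _ => edgeMatrix_nonneg hf hg _ _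

theorem sum_graphTransition : ∑ H', graphTransition (edgeMatrix f g) H H' = 1 := by
  classical
  have := graphMean_eq_prod (edgeMatrix f g) H (F := fun _ => 1) (fun _ _ => 1) (by simp)
  simpa only [graphMean, mul_one, edgeMatrix_sum_row, Finset.prod_const_one] using this

theorem graphMean_mono (hf : f ∈ Set.Icc (0 : ℝ) 1) (hg : g ∈ Set.Icc (0 : ℝ) 1)
    {F F' : SimpleGraph (Fin n) → ℝ} (h : ∀ H', F H' ≤ F' H') :
    graphMean (edgeMatrix f g) H F ≤ graphMean (edgeMatrix f g) H F' :=
  Finset.sum_le_sum fun H' _ =>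
    mul_le_mul_of_nonneg_left (h H') (graphTransition_nonneg H hf hg H')

open Classical in
/-- The probability that prescribed potential edges are in prescribed states. -/
theorem graphMean_edgeState (A : Finset (Sym2 (Fin n)))
    (hA : A ⊆ (⊤ : SimpleGraph (Fin n)).edgeFinset) (τ : Sym2 (Fin n) → Fin 2) :
    graphMean (edgeMatrix f g) H (fun H' => if ∀ e ∈ A, edgeState H' e = τ e then 1 else 0) =
      ∏ e ∈ A, edgeMatrix f g (edgeState H e) (τ e) := by
  let h : Sym2 (Fin n) → Fin 2 → ℝ := fun e s =>
    if e ∈ A then (if s = τ e then (1 : ℝ) else 0) else 1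
  have h1 : ∀ H' : SimpleGraph (Fin n),
      (if ∀ e ∈ A, edgeState H' e = τ e then (1 : ℝ) else 0) =
        ∏ e ∈ (⊤ : SimpleGraph (Fin n)).edgeFinset, h e (edgeState H' e) := by
    intro H'
    rw [← Finset.prod_subset hA (fun e _ he => by simp [h, he])]
    rw [Finset.prod_congr rfl (g := fun e => if edgeState H' e = τ e then (1 : ℝ) else 0)
      (fun e he => by simp [h, he]), Finset.prod_boole]
    congr
  rw [graphMean_eq_prod _ _ h h1, ← Finset.prod_subset hA]
  · refine Finset.prod_congr rfl fun e he => ?_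
    simp [h, he]
  · intro e _ he
    simp only [h, he, if_false, mul_one, edgeMatrix_sum_row]

open Classical in
theorem prod_incidenceFinset_top_ite (v : Fin n) (b c : ℝ) :
    ∏ e ∈ (⊤ : SimpleGraph (Fin n)).incidenceFinset v, (if e ∈ H.edgeSet then b else c) =
      b ^ H.degree v * c ^ (n - 1 - H.degree v) := by
  have h : ((⊤ : SimpleGraph (Fin n)).incidenceFinset v).filter (· ∈ H.edgeSet) =
      H.incidenceFinset v := by
    ext e
    simp only [Finset.mem_filter, SimpleGraph.mem_incidenceFinset, SimpleGraph.incidenceSet,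
      Set.mem_ofPred_eq]
    constructor
    · rintro ⟨⟨_, h⟩, h'⟩
      exact ⟨h', h⟩
    · rintro ⟨h, h'⟩
      exact ⟨⟨SimpleGraph.edgeSet_mono le_top h, h'⟩, h⟩
  have hc := Finset.card_filter_add_card_filter_not
    (s := (⊤ : SimpleGraph (Fin n)).incidenceFinset v) (· ∈ H.edgeSet)
  rw [h, SimpleGraph.card_incidenceFinset_eq_degree, SimpleGraph.card_incidenceFinset_eq_degree,
    SimpleGraph.complete_graph_degree, Fintype.card_fin] at hc
  rw [Finset.prod_ite, Finset.prod_const, Finset.prod_const, h,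
    SimpleGraph.card_incidenceFinset_eq_degree]
  congr 2
  omega

open Classical in
/-- The generating function of the degree of a vertex after one step. -/
theorem graphMean_pow_degree (v : Fin n) (x : ℝ) :
    graphMean (edgeMatrix f g) H (fun H' => (1 + x) ^ H'.degree v) =
      (1 + x * g) ^ H.degree v * (1 + x * f) ^ (n - 1 - H.degree v) := by
  have hA : (⊤ : SimpleGraph (Fin n)).incidenceFinset v ⊆
      (⊤ : SimpleGraph (Fin n)).edgeFinset := SimpleGraph.incidenceFinset_subset _ _
  let h : Sym2 (Fin n) → Fin 2 → ℝ := fun e s =>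
    if e ∈ (⊤ : SimpleGraph (Fin n)).incidenceFinset v then (if s = 1 then 1 + x else 1) else 1
  have h1 : ∀ H' : SimpleGraph (Fin n), (1 + x) ^ H'.degree v =
      ∏ e ∈ (⊤ : SimpleGraph (Fin n)).edgeFinset, h e (edgeState H' e) := by
    intro H'
    rw [← Finset.prod_subset hA (fun e _ he => by simp only [h, he, if_false])]
    rw [Finset.prod_congr rfl (g := fun e => if e ∈ H'.edgeSet then 1 + x else 1)
      (fun e he => by simp only [h, he, if_true, edgeState_eq_one]), prod_incidenceFinset_top_ite]
    simp
  rw [graphMean_eq_prod _ _ h h1, ← Finset.prod_subset hA, ← prod_incidenceFinset_top_ite]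
  · refine Finset.prod_congr rfl fun e he => ?_
    simp only [h, he, if_true, Fin.sum_univ_two]
    by_cases heH : e ∈ H.edgeSet
    · rw [edgeState_eq_one.2 heH, if_pos heH]
      simp [edgeMatrix]
      ring
    · rw [edgeState_eq_zero.2 heH, if_neg heH]
      simp [edgeMatrix]
      ring
  · intro e _ he
    simp only [h, he, if_false, mul_one, edgeMatrix_sum_row]

/-- `u` is the only neighbour of `v`. -/
def IsOnlyNeighbor (G : SimpleGraph (Fin n)) (v u : Fin n) : Prop :=
  ∀ w, G.Adj v w ↔ w = u

open Classical in
/-- Lower bound for the probability that `u` becomes the only neighbour of `v`. -/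
theorem le_graphMean_isOnlyNeighbor (hf : f ∈ Set.Icc (0 : ℝ) 1) (hg : g ∈ Set.Icc (0 : ℝ) 1)
    {v u : Fin n} (huv : v ≠ u) (hH : ¬ H.Adj v u) :
    f * ((1 - f) ^ n * (1 - g) ^ H.degree v) ≤
      graphMean (edgeMatrix f g) H (fun H' => if IsOnlyNeighbor H' v u then 1 else 0) := by
  set A := (⊤ : SimpleGraph (Fin n)).incidenceFinset v with hAdef
  have hA : A ⊆ (⊤ : SimpleGraph (Fin n)).edgeFinset := SimpleGraph.incidenceFinset_subset _ _
  have hmem : ∀ e, e ∈ A ↔ ∃ w, w ≠ v ∧ e = s(v, w) := by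
    intro e
    rw [hAdef, SimpleGraph.mem_incidenceFinset]
    induction e with
    | _ x y =>
      simp only [SimpleGraph.mk'_mem_incidenceSet_iff, SimpleGraph.top_adj]
      constructor
      · rintro ⟨hxy, rfl | rfl⟩
        · exact ⟨y, hxy.symm, rfl⟩
        · exact ⟨x, hxy, Sym2.eq_swap⟩
      · rintro ⟨w, hw, h⟩
        rcases Sym2.eq_iff.1 h with ⟨rfl, rfl⟩ | ⟨rfl, rfl⟩
        · exact ⟨hw.symm, Or.inl rfl⟩
        · exact ⟨hw, Or.inr rfl⟩
  set τ : Sym2 (Fin n) → Fin 2 := fun e => if e = s(v, u) then 1 else 0 with hτ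
  have hev : ∀ H' : SimpleGraph (Fin n),
      IsOnlyNeighbor H' v u ↔ ∀ e ∈ A, edgeState H' e = τ e := by
    intro H'
    constructor
    · intro h e he
      obtain ⟨w, hw, rfl⟩ := (hmem e).1 he
      by_cases hwu : w = u
      · subst hwu
        simp only [hτ, if_true, edgeState_eq_one, SimpleGraph.mem_edgeSet]
        exact (h w).2 rfl
      · have : s(v, w) ≠ s(v, u) := fun h' => hwu (Sym2.congr_right.1 h')
        simp only [hτ, this, if_false, edgeState_eq_zero, SimpleGraph.mem_edgeSet]
        exact fun h' => hwu ((h w).1 h')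
    · intro h w
      by_cases hwv : w = v
      · subst hwv
        simp [huv]
      · have h2 := h _ ((hmem _).2 ⟨w, hwv, rfl⟩)
        by_cases hwu : w = u
        · subst hwu
          simp only [hτ, if_true, edgeState_eq_one, SimpleGraph.mem_edgeSet] at h2
          simp [h2]
        · have : s(v, w) ≠ s(v, u) := fun h' => hwu (Sym2.congr_right.1 h')
          simp only [hτ, this, if_false, edgeState_eq_zero, SimpleGraph.mem_edgeSet] at h2
          simp [h2, hwu]
  simp_rw [hev]
  rw [graphMean_edgeState H A hA τ]
  have huA : s(v, u) ∈ A := (hmem _).2 ⟨u, huv.symm, rfl⟩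
  rw [← Finset.mul_prod_erase A _ huA]
  have e1 : edgeMatrix f g (edgeState H s(v, u)) (τ s(v, u)) = f := by
    rw [edgeState_eq_zero.2 (by simpa using hH)]
    simp [hτ, edgeMatrix]
  rw [e1]
  refine mul_le_mul_of_nonneg_left ?_ hf.1
  have e2 : ∏ e ∈ A.erase s(v, u), edgeMatrix f g (edgeState H e) (τ e) =
      ∏ e ∈ A.erase s(v, u), (if e ∈ H.edgeSet then 1 - g else 1 - f) := by
    refine Finset.prod_congr rfl fun e he => ?_
    have hne := Finset.ne_of_mem_erase he
    by_cases h : e ∈ H.edgeSet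
    · rw [edgeState_eq_one.2 h, if_pos h]
      simp [hτ, hne, edgeMatrix]
    · rw [edgeState_eq_zero.2 h, if_neg h]
      simp [hτ, hne, edgeMatrix]
  have hf1 : 0 ≤ 1 - f := by linarith [hf.2]
  have hg1 : 0 ≤ 1 - g := by linarith [hg.2]
  have hx : ∀ e, 0 ≤ (if e ∈ H.edgeSet then 1 - g else 1 - f) := fun e => by
    split_ifs <;> assumption
  rw [e2]
  calc (1 - f) ^ n * (1 - g) ^ H.degree v
      ≤ (1 - g) ^ H.degree v * (1 - f) ^ (n - 1 - H.degree v) := by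
        rw [mul_comm]
        exact mul_le_mul_of_nonneg_left
          (pow_le_pow_of_le_one hf1 (by linarith [hf.1]) (by omega)) (pow_nonneg hg1 _)
    _ = ∏ e ∈ A, (if e ∈ H.edgeSet then 1 - g else 1 - f) :=
        (prod_incidenceFinset_top_ite H v _ _).symm
    _ = (if s(v, u) ∈ H.edgeSet then 1 - g else 1 - f) *
          ∏ e ∈ A.erase s(v, u), (if e ∈ H.edgeSet then 1 - g else 1 - f) :=
        (Finset.mul_prod_erase A _ huA).symm
    -- The factor of the pair itself is at most `1`; discarding it leaves exactly the requirement on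
    -- the other edges at `v`.
    _ ≤ 1 * ∏ e ∈ A.erase s(v, u), (if e ∈ H.edgeSet then 1 - g else 1 - f) := by
        refine mul_le_mul_of_nonneg_right ?_ (Finset.prod_nonneg fun e _ => hx e)
        split_ifs
        · linarith [hg.1]
        · linarith [hf.1]
    _ = _ := one_mul _

open Classical in
/-- The probability that two potential edges absent from `H` are both present after one step. -/
theorem graphMean_mem_and_mem {e e' : Sym2 (Fin n)}
    (he : e ∈ (⊤ : SimpleGraph (Fin n)).edgeFinset)
    (he' : e' ∈ (⊤ : SimpleGraph (Fin n)).edgeFinset) (hH : e ∉ H.edgeSet) (hH' : e' ∉ H.edgeSet) :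
    graphMean (edgeMatrix f g) H
        (fun H' => if e ∈ H'.edgeSet ∧ e' ∈ H'.edgeSet then 1 else 0) =
      if e = e' then f else f * f := by
  have h := graphMean_edgeState (f := f) (g := g) H {e, e'}
    (by simp only [Finset.insert_subset_iff, Finset.singleton_subset_iff]; exact ⟨he, he'⟩)
    (fun _ => 1)
  simp only [Finset.mem_insert, Finset.mem_singleton, forall_eq_or_imp, forall_eq,
    edgeState_eq_one] at h
  rw [h]
  split_ifs with hee
  · subst hee
    simp [edgeState_eq_zero.2 hH, edgeMatrix]
  · rw [Finset.prod_pair hee, edgeState_eq_zero.2 hH, edgeState_eq_zero.2 hH']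
    simp [edgeMatrix]

end EdgeProducts

/-! ### Elimination of the contacts -/

section Drift

variable {n : ℕ}

theorem contactProb_nonneg (G : SimpleGraph (Fin n)) (v : Fin n) (o : Option (Fin n)) :
    0 ≤ contactProb G v o := by
  classical
  cases o <;> simp only [contactProb] <;> split_ifs <;> positivity

theorem sum_contactProb (G : SimpleGraph (Fin n)) (v : Fin n) : ∑ o, contactProb G v o = 1 := by
  classical
  rw [Fintype.sum_option]
  simp only [contactProb]
  rw [← Finset.sum_filter, Finset.sum_const, ← SimpleGraph.neighborFinset_eq_filter,
    SimpleGraph.card_neighborFinset_eq_degree, nsmul_eq_mul]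
  split_ifs with h
  · simp [h]
  · rw [zero_add]
    exact mul_one_div_cancel (Nat.cast_ne_zero.2 h)

theorem sum_prod_contactProb (G : SimpleGraph (Fin n)) :
    ∑ c : Fin n → Option (Fin n), ∏ v, contactProb G v (c v) = 1 := by
  classical
  rw [← Fintype.piFinset_univ, ← Finset.prod_univ_sum]
  exact Finset.prod_eq_one fun v _ => sum_contactProb G v

/-- With a single neighbour there is no choice left, so every contact of positive probability goes
there. -/
theorem IsOnlyNeighbor.contact_eq {G : SimpleGraph (Fin n)} {v u : Fin n}
    (h : IsOnlyNeighbor G v u) {o : Option (Fin n)} (ho : contactProb G v o ≠ 0) : o = some u := by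
  classical
  cases o with
  | none =>
    simp only [contactProb] at ho
    have hd : G.degree v = 0 := by
      by_contra hd
      exact ho (if_neg (by convert hd))
    have : u ∈ G.neighborFinset v := by simpa using (h u).2 rfl
    rw [Finset.card_eq_zero.1 hd] at this
    simp at this
  | some w =>
    simp only [contactProb] at ho
    have : G.Adj v w := by
      by_contra hw
      exact ho (if_neg hw)
    rw [(h w).1 this]

open Classical in
/-- The pairs of an uninformed and an informed vertex that are not adjacent in `H`. -/
noncomputable def cutPairs (H : SimpleGraph (Fin n)) (I : Finset (Fin n)) :
    Finset (Fin n × Fin n) :=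
  Finset.univ.filter fun p => p.1 ∉ I ∧ p.2 ∈ I ∧ ¬ H.Adj p.1 p.2

theorem mem_cutPairs {H : SimpleGraph (Fin n)} {I : Finset (Fin n)} {p : Fin n × Fin n} :
    p ∈ cutPairs H I ↔ p.1 ∉ I ∧ p.2 ∈ I ∧ ¬ H.Adj p.1 p.2 := by
  simp [cutPairs]

open Classical in
/-- The number of pairs in `cutPairs H I` in which the informed vertex is the only neighbour of the
uninformed one in `H'`. -/
noncomputable def leafCount (H : SimpleGraph (Fin n)) (I : Finset (Fin n))
    (H' : SimpleGraph (Fin n)) : ℝ :=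
  ∑ p ∈ cutPairs H I, if IsOnlyNeighbor H' p.1 p.2 then 1 else 0

theorem leafCount_nonneg (H : SimpleGraph (Fin n)) (I : Finset (Fin n))
    (H' : SimpleGraph (Fin n)) : 0 ≤ leafCount H I H' :=
  Finset.sum_nonneg fun _ _ => by split_ifs <;> norm_num

/-- A vertex has at most one sole neighbour, so projecting the counted pairs to their uninformed
vertex is injective and no new vertex is counted twice. -/
theorem card_add_leafCount_le (H : SimpleGraph (Fin n)) (I J : Finset (Fin n))
    (H' : SimpleGraph (Fin n)) (hIJ : I ⊆ J)
    (hJ : ∀ v ∉ I, ∀ u ∈ I, IsOnlyNeighbor H' v u → v ∈ J) :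
    (I.card : ℝ) + leafCount H I H' ≤ J.card := by
  classical
  set L := (cutPairs H I).filter fun p => IsOnlyNeighbor H' p.1 p.2
  have h1 : leafCount H I H' = L.card := by
    simp [leafCount, L, Finset.sum_boole]
  have h2 : L.card ≤ (J \ I).card := by
    refine Finset.card_le_card_of_injOn Prod.fst (fun p hp => ?_) (fun p hp q hq hpq => ?_)
    · obtain ⟨hp, hl⟩ := Finset.mem_filter.1 hp
      obtain ⟨h1, h2, -⟩ := mem_cutPairs.1 hp
      exact Finset.mem_coe.2 (Finset.mem_sdiff.2 ⟨hJ _ h1 _ h2 hl, h1⟩)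
    · have hl := (Finset.mem_filter.1 hp).2
      have hl' := (Finset.mem_filter.1 hq).2
      refine Prod.ext hpq ((hl' _).1 ?_)
      rw [← hpq]
      exact (hl _).2 rfl
  rw [Finset.card_sdiff_of_subset hIJ] at h2
  rw [h1]
  have := Finset.card_le_card hIJ
  exact_mod_cast (by omega : I.card + L.card ≤ J.card)

/-- The randomness of the contacts can be eliminated: vertices whose only neighbour is informed
become informed for sure. -/
theorem stepMean_le_graphMean {f g : ℝ} (hf : f ∈ Set.Icc (0 : ℝ) 1)
    (hg : g ∈ Set.Icc (0 : ℝ) 1) {φ : ℝ → ℝ} (hφ : AntitoneOn φ (Set.Ioi 0))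
    (H : SimpleGraph (Fin n)) {I : Finset (Fin n)} (hI : I.Nonempty) :
    stepMean (edgeMatrix f g) (fun _ J => φ J.card) H I ≤
      graphMean (edgeMatrix f g) H (fun H' => φ (I.card + leafCount H I H')) := by
  refine Finset.sum_le_sum fun H' _ =>
    mul_le_mul_of_nonneg_left ?_ (graphTransition_nonneg H hf hg H')
  calc ∑ c : Fin n → Option (Fin n), (∏ v, contactProb H' v (c v)) * φ (pull n c I).card
      ≤ ∑ c : Fin n → Option (Fin n), (∏ v, contactProb H' v (c v)) *
          φ (I.card + leafCount H I H') := by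
        refine Finset.sum_le_sum fun c _ => ?_
        by_cases hc : ∏ v, contactProb H' v (c v) = 0
        · simp [hc]
        refine mul_le_mul_of_nonneg_left ?_
          (Finset.prod_nonneg fun v _ => contactProb_nonneg _ _ _)
        have hpos : (0 : ℝ) < I.card := by exact_mod_cast hI.card_pos
        have hle : (I.card : ℝ) + leafCount H I H' ≤ (pull n c I).card := by
          refine card_add_leafCount_le H I _ H' (subset_pull c I) fun v _ u hu hl => ?_
          have hcv : c v = some u :=
            hl.contact_eq (Finset.prod_ne_zero_iff.1 hc v (Finset.mem_univ v))
          simp only [pull, Finset.mem_union, Finset.mem_filter, Finset.mem_univ, true_and]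
          exact Or.inr ⟨u, hu, hcv⟩
        have h0 := leafCount_nonneg H I H'
        exact hφ (Set.mem_Ioi.2 (by linarith)) (Set.mem_Ioi.2 (by linarith)) hle
    _ = φ (I.card + leafCount H I H') := by
        rw [← Finset.sum_mul, sum_prod_contactProb, one_mul]

/-! ### First and second moments of the leaf count -/

section Moments

variable {f g : ℝ} (H : SimpleGraph (Fin n)) (I : Finset (Fin n))

theorem graphMean_sum {P : Matrix (Fin 2) (Fin 2) ℝ} {ι : Type*} (s : Finset ι)
    (F : ι → SimpleGraph (Fin n) → ℝ) :
    graphMean P H (fun H' => ∑ i ∈ s, F i H') = ∑ i ∈ s, graphMean P H (F i) := by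
  simp_rw [graphMean, Finset.mul_sum]
  exact Finset.sum_comm

theorem graphMean_quadratic (F : SimpleGraph (Fin n) → ℝ) (p q r : ℝ) :
    graphMean (edgeMatrix f g) H (fun H' => p + q * F H' + r * F H' ^ 2) =
      p + q * graphMean (edgeMatrix f g) H F +
        r * graphMean (edgeMatrix f g) H (fun H' => F H' ^ 2) := by
  have h := sum_graphTransition (f := f) (g := g) H
  have h2 : p = ∑ H', graphTransition (edgeMatrix f g) H H' * p := by
    rw [← Finset.sum_mul, h, one_mul]
  conv_rhs => rw [h2]
  simp_rw [graphMean, Finset.mul_sum, ← Finset.sum_add_distrib]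
  exact Finset.sum_congr rfl fun _ _ => by ring

open Classical in
theorem le_graphMean_leafCount (hf : f ∈ Set.Icc (0 : ℝ) 1) (hg : g ∈ Set.Icc (0 : ℝ) 1)
    {q : ℝ} (hq : ∀ v, q ≤ (1 - f) ^ n * (1 - g) ^ H.degree v) :
    (cutPairs H I).card * (f * q) ≤ graphMean (edgeMatrix f g) H (leafCount H I) := by
  have e : graphMean (edgeMatrix f g) H (leafCount H I) = ∑ p ∈ cutPairs H I,
      graphMean (edgeMatrix f g) H (fun H' => if IsOnlyNeighbor H' p.1 p.2 then 1 else 0) :=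
    graphMean_sum H _ _
  rw [e, ← nsmul_eq_mul]
  refine Finset.card_nsmul_le_sum _ _ _ fun p hp => ?_
  obtain ⟨h1, h2, h3⟩ := mem_cutPairs.1 hp
  exact (mul_le_mul_of_nonneg_left (hq p.1) hf.1).trans
    (le_graphMean_isOnlyNeighbor H hf hg (fun h => h1 (h ▸ h2)) h3)

/-- For an upper bound, being the only neighbour may be weakened to mere adjacency. Distinct cut
pairs have distinct edges, which are independent, so only the diagonal adds to the squared mean
bound. -/
theorem graphMean_leafCount_sq_le (hf : f ∈ Set.Icc (0 : ℝ) 1) (hg : g ∈ Set.Icc (0 : ℝ) 1) :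
    graphMean (edgeMatrix f g) H (fun H' => leafCount H I H' ^ 2) ≤
      ((cutPairs H I).card * f) ^ 2 + (cutPairs H I).card * f := by
  classical
  set S := cutPairs H I with hS
  have hadj : ∀ {H' : SimpleGraph (Fin n)} {p : Fin n × Fin n}, IsOnlyNeighbor H' p.1 p.2 →
      s(p.1, p.2) ∈ H'.edgeSet := fun h => (h _).2 rfl
  calc graphMean (edgeMatrix f g) H (fun H' => leafCount H I H' ^ 2)
      ≤ graphMean (edgeMatrix f g) H (fun H' => ∑ p ∈ S, ∑ q ∈ S,
          if s(p.1, p.2) ∈ H'.edgeSet ∧ s(q.1, q.2) ∈ H'.edgeSet then (1 : ℝ) else 0) := by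
        refine graphMean_mono H hf hg fun H' => ?_
        rw [leafCount, sq, Finset.sum_mul_sum]
        refine Finset.sum_le_sum fun p _ => Finset.sum_le_sum fun q _ => ?_
        by_cases hp : IsOnlyNeighbor H' p.1 p.2
        · by_cases hq : IsOnlyNeighbor H' q.1 q.2
          · simp [hp, hq, hadj hp, hadj hq, -SimpleGraph.mem_edgeSet]
          · rw [if_neg hq, mul_zero]
            split_ifs <;> norm_num
        · rw [if_neg hp, zero_mul]
          split_ifs <;> norm_num
    _ = ∑ p ∈ S, ∑ q ∈ S, (if s(p.1, p.2) = s(q.1, q.2) then f else f * f) := by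
        rw [graphMean_sum]
        refine Finset.sum_congr rfl fun p hp => ?_
        rw [graphMean_sum]
        refine Finset.sum_congr rfl fun q hq => ?_
        obtain ⟨h1, h2, h3⟩ := mem_cutPairs.1 hp
        obtain ⟨h1', h2', h3'⟩ := mem_cutPairs.1 hq
        refine graphMean_mem_and_mem H ?_ ?_ h3 h3'
        · simpa using fun h : p.1 = p.2 => h1 (h ▸ h2)
        · simpa using fun h : q.1 = q.2 => h1' (h ▸ h2')
    _ ≤ ∑ p ∈ S, ∑ q ∈ S, ((if p = q then f else 0) + f * f) := by
        refine Finset.sum_le_sum fun p hp => Finset.sum_le_sum fun q hq => ?_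
        have hff : 0 ≤ f * f := mul_self_nonneg f
        split_ifs with h h' h'
        · linarith
        · exfalso
          obtain ⟨h1, h2, h3⟩ := mem_cutPairs.1 hp
          obtain ⟨h1', h2', h3'⟩ := mem_cutPairs.1 hq
          rcases Sym2.eq_iff.1 h with ⟨ha, hb⟩ | ⟨ha, hb⟩
          · exact h' (Prod.ext ha hb)
          -- Two cut pairs cannot be reversals of each other: the first vertex is uninformed and the
          -- second informed.
          · exact h1 (ha ▸ h2')
        · linarith [hf.1]
        · linarith
    _ = _ := by
        simp_rw [Finset.sum_add_distrib, Finset.sum_ite_eq, Finset.sum_const, nsmul_eq_mul]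
        rw [Finset.sum_congr rfl (g := fun _ => f) (fun p hp => by simp [hp]), Finset.sum_const,
          nsmul_eq_mul]
        ring

theorem card_cutPairs_le : (cutPairs H I).card ≤ n * I.card := by
  classical
  calc (cutPairs H I).card ≤ (Finset.univ ×ˢ I).card :=
        Finset.card_le_card fun p hp => by simp [(mem_cutPairs.1 hp).2.1]
    _ = n * I.card := by simp

-- The edges across the cut are counted from each side in turn. The first bound serves small
-- informed sets, the second large ones.
open Classical in
theorem le_card_cutPairs_of_degree_le {D : ℕ} (hD : ∀ v, H.degree v ≤ D) :
    I.card * (n - I.card) ≤ (cutPairs H I).card + I.card * D ∧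
      I.card * (n - I.card) ≤ (cutPairs H I).card + (n - I.card) * D := by
  set B : Finset (Fin n × Fin n) := (Iᶜ ×ˢ I).filter fun p => H.Adj p.1 p.2 with hB
  have hsum : I.card * (n - I.card) = (cutPairs H I).card + B.card := by
    have h1 : (Iᶜ ×ˢ I).card = I.card * (n - I.card) := by
      rw [Finset.card_product, Finset.card_compl, Fintype.card_fin, mul_comm]
    rw [← h1, ← Finset.card_filter_add_card_filter_not (s := Iᶜ ×ˢ I) (fun p => H.Adj p.1 p.2),
      add_comm]
    congr 2
    ext p
    simp [mem_cutPairs, and_assoc]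
  have hB1 : B.card ≤ I.card * D := by
    rw [← smul_eq_mul]
    have := Finset.card_eq_sum_card_fiberwise (s := B) (t := I) (f := Prod.snd)
      (fun p hp => by
        have := (Finset.mem_product.1 (Finset.mem_filter.1 hp).1).2
        exact this)
    rw [this]
    refine Finset.sum_le_card_nsmul _ _ _ fun u _ => le_trans ?_ (hD u)
    rw [← SimpleGraph.card_neighborFinset_eq_degree]
    refine Finset.card_le_card_of_injOn Prod.fst (fun p hp => ?_) (fun p hp q hq hpq => ?_)
    · obtain ⟨hpB, rfl⟩ := Finset.mem_filter.1 hp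
      have hadj : H.Adj p.1 p.2 := (Finset.mem_filter.1 hpB).2
      simpa using hadj.symm
    · exact Prod.ext hpq ((Finset.mem_filter.1 hp).2.trans (Finset.mem_filter.1 hq).2.symm)
  have hB2 : B.card ≤ (n - I.card) * D := by
    have hc : n - I.card = Iᶜ.card := by rw [Finset.card_compl, Fintype.card_fin]
    rw [hc, ← smul_eq_mul]
    have := Finset.card_eq_sum_card_fiberwise (s := B) (t := Iᶜ) (f := Prod.fst)
      (fun p hp => by
        have := (Finset.mem_product.1 (Finset.mem_filter.1 hp).1).1
        exact this)
    rw [this]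
    refine Finset.sum_le_card_nsmul _ _ _ fun u _ => le_trans ?_ (hD u)
    rw [← SimpleGraph.card_neighborFinset_eq_degree]
    refine Finset.card_le_card_of_injOn Prod.snd (fun p hp => ?_) (fun p hp q hq hpq => ?_)
    · obtain ⟨hpB, rfl⟩ := Finset.mem_filter.1 hp
      have hadj : H.Adj p.1 p.2 := (Finset.mem_filter.1 hpB).2
      simpa using hadj
    · exact Prod.ext ((Finset.mem_filter.1 hp).2.trans (Finset.mem_filter.1 hq).2.symm) hpq
  omega

end Moments

/-! ### Contraction of the potential -/

/-- A quadratic bound for `1 / (k + y)`, tangent at `y = z * k`. -/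
theorem one_div_add_le {k y z : ℝ} (hk : 0 < k) (hy : 0 ≤ y) (hz : 0 ≤ z) :
    1 / (k + y) ≤ 1 / k + -((1 + 2 * z) / ((1 + z) ^ 2 * k ^ 2)) * y +
      1 / ((1 + z) ^ 2 * k ^ 3) * y ^ 2 := by
  have h : 1 / k + -((1 + 2 * z) / ((1 + z) ^ 2 * k ^ 2)) * y +
      1 / ((1 + z) ^ 2 * k ^ 3) * y ^ 2 - 1 / (k + y) =
        y * (y - z * k) ^ 2 / ((1 + z) ^ 2 * k ^ 3 * (k + y)) := by
    have : k + y ≠ 0 := by positivity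
    have : 1 + z ≠ 0 := by positivity
    field_simp
    ring
  have : 0 ≤ y * (y - z * k) ^ 2 / ((1 + z) ^ 2 * k ^ 3 * (k + y)) := by positivity
  linarith

open Classical in
/-- The potential `n / |I| - 1` decreases by a constant factor on average when the current graph
has small degrees. -/
theorem stepMean_potential_le {f g a q z δ : ℝ} {D : ℕ} (hf : f ∈ Set.Icc (0 : ℝ) 1)
    (hg : g ∈ Set.Icc (0 : ℝ) 1) (ha : 0 < a) (hq : 0 < q) (hz : 0 ≤ z)
    (hfn : a / 2 ≤ f * n) (hfn' : f * n ≤ 2 * a) (H : SimpleGraph (Fin n))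
    (hqH : ∀ v, q ≤ (1 - f) ^ n * (1 - g) ^ H.degree v) (hD : ∀ v, H.degree v ≤ D)
    (hDn : 4 * D ≤ n) (hzq : 4 * a ^ 2 + 2 * a ≤ 2 * z * (a * q / 8))
    (hδ : δ ≤ a * q / 8 / (1 + z) ^ 2) {I : Finset (Fin n)} (hI : I.Nonempty) :
    stepMean (edgeMatrix f g) (fun _ J => n / (J.card : ℝ) - 1) H I ≤
      (1 - δ) * (n / (I.card : ℝ) - 1) := by
  set c := a * q / 8 with hc
  have hc0 : 0 < c := by positivity
  set k : ℝ := (I.card : ℝ) with hk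
  have hk0 : 0 < k := Nat.cast_pos.2 hI.card_pos
  have hIn : I.card ≤ n := by simpa using Finset.card_le_univ I
  have hkn : k ≤ n := Nat.cast_le.2 hIn
  have hn0 : (0 : ℝ) < n := hk0.trans_le hkn
  set N : ℝ := ((cutPairs H I).card : ℝ) with hN
  have hN0 : 0 ≤ N := Nat.cast_nonneg _
  have hDn' : 4 * (D : ℝ) ≤ n := by exact_mod_cast hDn
  obtain ⟨hN1, hN2⟩ : k * (n - k) ≤ N + k * D ∧ k * (n - k) ≤ N + (n - k) * D := by
    have h := le_card_cutPairs_of_degree_le H I hD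
    have hs : ((n - I.card : ℕ) : ℝ) = n - k := Nat.cast_sub hIn
    rw [← hs, hk, hN]
    exact_mod_cast h
  have hstep := stepMean_le_graphMean hf hg (φ := fun x => n / x - 1)
    (fun x hx y _ hxy => sub_le_sub_right (div_le_div_of_nonneg_left hn0.le hx hxy) 1) H hI
  have hmean := le_graphMean_leafCount H I hf hg hqH
  rw [← hN] at hmean
  have hcδ : c / (1 + z) ^ 2 ≤ c := div_le_self hc0.le (by nlinarith)
  have hfac : 0 ≤ n / k - 1 := by
    rw [sub_nonneg, le_div_iff₀ hk0]
    linarith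
  set Y := leafCount H I
  have hY0 : ∀ H', 0 ≤ Y H' := leafCount_nonneg H I
  refine hstep.trans ?_
  have hfq : 0 ≤ f * q := mul_nonneg hf.1 hq.le
  -- Up to half the vertices, growth is multiplicative and the convexity of `1 / (k + y)` must be
  -- controlled by the second moment. Beyond half, the uninformed part shrinks and a linear bound is
  -- enough.
  rcases le_total (2 * k) n with hkn2 | hkn2
  · have hNk : k * (n / 4) ≤ N := by nlinarith
    have hEY : k * c ≤ graphMean (edgeMatrix f g) H Y := by
      refine le_trans ?_ hmean
      calc k * c = k * (a / 2 * q / 4) := by rw [hc]; ring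
        _ ≤ k * (f * n * q / 4) := by gcongr
        _ = k * (n / 4) * (f * q) := by ring
        _ ≤ N * (f * q) := by gcongr
    have hNf : N * f ≤ k * (2 * a) := by
      have : N ≤ n * k := by
        rw [hN, hk]
        exact_mod_cast card_cutPairs_le H I
      calc N * f ≤ n * k * f := by gcongr; exact hf.1
        _ = k * (f * n) := by ring
        _ ≤ k * (2 * a) := by gcongr
    have hEY2 : graphMean (edgeMatrix f g) H (fun H' => Y H' ^ 2) ≤
        (4 * a ^ 2 + 2 * a) * k ^ 2 := by
      refine (graphMean_leafCount_sq_le H I hf hg).trans ?_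
      rw [← hN]
      have h1 : (N * f) ^ 2 ≤ (k * (2 * a)) ^ 2 :=
        pow_le_pow_left₀ (mul_nonneg hN0 hf.1) hNf 2
      have hk1 : 1 ≤ k := by
        rw [hk]
        exact_mod_cast hI.card_pos
      have h2 : k * (2 * a) ≤ k ^ 2 * (2 * a) := by
        gcongr
        nlinarith
      nlinarith
    have hquad : graphMean (edgeMatrix f g) H (fun H' => n / (k + Y H') - 1) ≤
        (n / k - 1) + -(n * ((1 + 2 * z) / ((1 + z) ^ 2 * k ^ 2))) *
          graphMean (edgeMatrix f g) H Y + n * (1 / ((1 + z) ^ 2 * k ^ 3)) *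
          graphMean (edgeMatrix f g) H (fun H' => Y H' ^ 2) := by
      rw [← graphMean_quadratic]
      refine graphMean_mono H hf hg fun H' => ?_
      have h := mul_le_mul_of_nonneg_left (one_div_add_le hk0 (hY0 H') hz) hn0.le
      have e1 : n / (k + Y H') = n * (1 / (k + Y H')) := by ring
      have e2 : n / k = n * (1 / k) := by ring
      rw [e1, e2]
      linarith
    refine hquad.trans ?_
    have h1 : n * ((1 + 2 * z) / ((1 + z) ^ 2 * k ^ 2)) * (k * c) ≤
        n * ((1 + 2 * z) / ((1 + z) ^ 2 * k ^ 2)) * graphMean (edgeMatrix f g) H Y := by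
      gcongr
    have h2 : n * (1 / ((1 + z) ^ 2 * k ^ 3)) *
        graphMean (edgeMatrix f g) H (fun H' => Y H' ^ 2) ≤
        n * (1 / ((1 + z) ^ 2 * k ^ 3)) * (2 * z * c * k ^ 2) := by
      gcongr
      exact hEY2.trans (by gcongr)
    -- The choice of `z` bounds the second moment by `2 * z * c * k ^ 2`. The coefficients then
    -- combine to `2 * z - (1 + 2 * z) = -1`, leaving a net decrease.
    have h3 : n * (1 / ((1 + z) ^ 2 * k ^ 3)) * (2 * z * c * k ^ 2) -
        n * ((1 + 2 * z) / ((1 + z) ^ 2 * k ^ 2)) * (k * c) = -(c / (1 + z) ^ 2 * (n / k)) := by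
      have : 1 + z ≠ 0 := by positivity
      field_simp
      ring
    have h4 : c / (1 + z) ^ 2 * (n / k - 1) ≤ c / (1 + z) ^ 2 * (n / k) := by
      gcongr
      linarith
    have h5 : δ * (n / k - 1) ≤ c / (1 + z) ^ 2 * (n / k - 1) := by gcongr
    linarith
  · have hNk : (n - k) * (n / 4) ≤ N := by nlinarith
    have hnk : 0 ≤ n - k := by linarith
    have hEY : (n - k) * c ≤ graphMean (edgeMatrix f g) H Y := by
      refine le_trans ?_ hmean
      calc (n - k) * c = (n - k) * (a / 2 * q / 4) := by rw [hc]; ring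
        _ ≤ (n - k) * (f * n * q / 4) := by gcongr
        _ = (n - k) * (n / 4) * (f * q) := by ring
        _ ≤ N * (f * q) := by gcongr
    have hlin : graphMean (edgeMatrix f g) H (fun H' => n / (k + Y H') - 1) ≤
        (n - k) / k + -(1 / k) * graphMean (edgeMatrix f g) H Y + 0 *
          graphMean (edgeMatrix f g) H (fun H' => Y H' ^ 2) := by
      rw [← graphMean_quadratic]
      refine graphMean_mono H hf hg fun H' => ?_
      -- This keeps the numerator `n - (k + Y H')` nonnegative, so that the denominator may be
      -- lowered to `k`.
      have hYn : k + Y H' ≤ n := by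
        have := card_add_leafCount_le H I Finset.univ H' (Finset.subset_univ I)
          (fun _ _ _ _ _ => Finset.mem_univ _)
        simpa using this
      have hpos : 0 < k + Y H' := by linarith [hY0 H']
      calc n / (k + Y H') - 1 = (n - (k + Y H')) / (k + Y H') := by field_simp
        _ ≤ (n - (k + Y H')) / k := by
            apply div_le_div_of_nonneg_left (by linarith) hk0
            linarith [hY0 H']
        _ = _ := by ring
    refine hlin.trans ?_
    have h1 : 1 / k * ((n - k) * c) ≤ 1 / k * graphMean (edgeMatrix f g) H Y := by gcongr
    have h2 : 1 / k * ((n - k) * c) = c * (n / k - 1) := by field_simp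
    have h3 : (n - k) / k = n / k - 1 := by field_simp
    have h5 : δ * (n / k - 1) ≤ c * (n / k - 1) := by
      gcongr
      linarith
    linarith

end Drift

/-! ### Comparison of the protocols, and degree moments over one step -/

theorem completionTime_pushPull_le {n : ℕ} {Ω : Type*}
    (χ : ℕ → Ω → Fin n → Option (Fin n)) (v₀ : Fin n) (ω : Ω) :
    completionTime pushPull χ v₀ ω ≤ completionTime pull χ v₀ ω := by
  refine sInf_le_sInf ?_
  rintro _ ⟨t, rfl, ht⟩
  refine ⟨t, rfl, Finset.univ_subset_iff.1 ?_⟩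
  rw [← ht]
  exact informed_pull_subset_pushPull χ v₀ ω t

theorem CompletesInBigOWhp.pushPull {P : ℕ → Matrix (Fin 2) (Fin 2) ℝ} {r : ℕ → ℝ}
    (h : CompletesInBigOWhp.{u} pull P r) :
    CompletesInBigOWhp.{u} RumorSpreading.pushPull P r := by
  obtain ⟨C, hC, c, hc, N, H⟩ := h
  refine ⟨C, hC, c, hc, N, fun n hn Ω _ μ _ G χ v₀ hG hχ => ?_⟩
  refine (measure_mono fun ω hω => ?_).trans (H n hn Ω μ G χ v₀ hG hχ)
  exact lt_of_lt_of_le (Set.mem_ofPred.1 hω)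
    (ENat.toENNReal_le.2 (completionTime_pushPull_le χ v₀ ω))

-- The contacts sum out. One step replaces the parameter `x` by `x * g` at the cost of a factor `exp
-- (x * f * n)`, so under iteration the influence of the initial degree decays geometrically.
open Classical in
theorem stepMean_pow_degree_le {n : ℕ} {f g x : ℝ} (hf : 0 ≤ f) (hg : 0 ≤ g) (hx : 0 ≤ x)
    (v : Fin n) (H : SimpleGraph (Fin n)) (I : Finset (Fin n)) :
    stepMean (edgeMatrix f g) (fun H' _ => (1 + x) ^ H'.degree v) H I ≤
      Real.exp (x * (f * n)) * (1 + x * g) ^ H.degree v := by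
  have e : stepMean (edgeMatrix f g) (fun H' _ => (1 + x) ^ H'.degree v) H I =
      graphMean (edgeMatrix f g) H (fun H' => (1 + x) ^ H'.degree v) := by
    simp_rw [stepMean, graphMean, ← Finset.sum_mul, sum_prod_contactProb, one_mul]
  rw [e, graphMean_pow_degree, mul_comm]
  have hxf : 0 ≤ x * f := mul_nonneg hx hf
  have hxg : 0 ≤ x * g := mul_nonneg hx hg
  refine mul_le_mul_of_nonneg_right ?_ (by positivity)
  calc (1 + x * f) ^ (n - 1 - H.degree v) ≤ (1 + x * f) ^ n :=
        pow_le_pow_right₀ (by linarith) (by omega)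
    _ ≤ Real.exp (x * f) ^ n := by
        gcongr
        linarith [Real.add_one_le_exp (x * f)]
    _ = Real.exp (x * (f * n)) := by
        rw [← Real.exp_nat_mul]
        congr 1
        ring

theorem integrable_graph_informed {n : ℕ} {Ω : Type u} [MeasurableSpace Ω]
    {μ : Measure Ω} [IsFiniteMeasure μ] {G : ℕ → Ω → SimpleGraph (Fin n)}
    {χ : ℕ → Ω → Fin n → Option (Fin n)} {P : Matrix (Fin 2) (Fin 2) ℝ}
    (hG : IsEdgeMarkovian μ P G) (hχ : IsUniformContacts μ G χ) (v₀ : Fin n)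
    (F : SimpleGraph (Fin n) → Finset (Fin n) → ℝ) (t : ℕ) :
    Integrable (fun ω => F (G t ω) (informed pull χ v₀ ω (t + 1))) μ :=
  integrable_comp_of_finite (measurableSet_graph_informed hG hχ v₀ t) fun y => F y.1 y.2

/-! ### Degrees and potential over many rounds -/

section PullDynamics

variable {n : ℕ} {Ω : Type u} [MeasurableSpace Ω] {μ : Measure Ω} [IsProbabilityMeasure μ]
  {f g : ℝ} {G : ℕ → Ω → SimpleGraph (Fin n)} {χ : ℕ → Ω → Fin n → Option (Fin n)}

open Classical in
/-- Exponential moments of the degrees, whatever the initial graph. -/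
theorem integral_pow_degree_le (hf : 0 ≤ f) (hg : 0 ≤ g) (hg2 : g ≤ 1 / 2)
    (hG : IsEdgeMarkovian μ (edgeMatrix f g) G) (hχ : IsUniformContacts μ G χ) (v : Fin n)
    (j : ℕ) {x : ℝ} (hx : 0 ≤ x) :
    ∫ ω, (1 + x) ^ (G j ω).degree v ∂μ ≤ Real.exp (x * (2 * (f * n) + g ^ j * n)) := by
  induction j generalizing x with
  | zero =>
    have h : ∀ ω, (1 + x) ^ (G 0 ω).degree v ≤ Real.exp (x * (2 * (f * n) + g ^ 0 * n)) := by
      intro ω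
      have hdeg : (G 0 ω).degree v ≤ n := by
        simpa using ((G 0 ω).degree_lt_card_verts v).le
      calc (1 + x) ^ (G 0 ω).degree v ≤ (1 + x) ^ n :=
            pow_le_pow_right₀ (by linarith) hdeg
        _ ≤ Real.exp x ^ n := by
            gcongr
            linarith [Real.add_one_le_exp x]
        _ = Real.exp (x * n) := by
            rw [← Real.exp_nat_mul]
            congr 1
            ring
        _ ≤ _ := by
            gcongr
            have : 0 ≤ f * n := by positivity
            simp
            linarith
    calc ∫ ω, (1 + x) ^ (G 0 ω).degree v ∂μ
        ≤ ∫ _, Real.exp (x * (2 * (f * n) + g ^ 0 * n)) ∂μ :=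
          integral_mono (integrable_graph_informed hG hχ v (fun γ _ => (1 + x) ^ γ.degree v) 0)
            (integrable_const _) h
      _ = _ := by simp
  | succ j ih =>
    have hxg : 0 ≤ x * g := mul_nonneg hx hg
    calc ∫ ω, (1 + x) ^ (G (j + 1) ω).degree v ∂μ
        = ∫ ω, stepMean (edgeMatrix f g) (fun γ _ => (1 + x) ^ γ.degree v) (G j ω)
            (informed pull χ v ω (j + 1)) ∂μ :=
          integral_graph_informed_succ hG hχ v (fun γ _ => (1 + x) ^ γ.degree v) j
      _ ≤ ∫ ω, Real.exp (x * (f * n)) * (1 + x * g) ^ (G j ω).degree v ∂μ :=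
          integral_mono (integrable_graph_informed hG hχ v _ j)
            (integrable_graph_informed hG hχ v
              (fun γ _ => Real.exp (x * (f * n)) * (1 + x * g) ^ γ.degree v) j)
            fun ω => stepMean_pow_degree_le hf hg hx v _ _
      _ = Real.exp (x * (f * n)) * ∫ ω, (1 + x * g) ^ (G j ω).degree v ∂μ :=
          integral_const_mul _ _
      _ ≤ Real.exp (x * (f * n)) * Real.exp (x * g * (2 * (f * n) + g ^ j * n)) := by
          gcongr
          exact ih hxg
      -- The bound reproduces itself because `1 + 2 * g ≤ 2`; this is where `g ≤ 1 / 2` enters.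
      _ = Real.exp (x * ((1 + 2 * g) * (f * n) + g ^ (j + 1) * n)) := by
          rw [← Real.exp_add]
          congr 1
          ring
      _ ≤ _ := by
          gcongr
          linarith

open Classical in
/-- Quantitative form of the completion of the pull protocol for a fixed number of vertices. -/
theorem measureReal_informed_ne_univ_le {a q z δ b : ℝ} {D k : ℕ}
    (hf : f ∈ Set.Icc (0 : ℝ) 1) (hg : g ∈ Set.Icc (0 : ℝ) 1) (hg2 : g ≤ 1 / 2) (ha : 0 < a)
    (hq : 0 < q) (hz : 0 ≤ z) (hfn : a / 2 ≤ f * n) (hfn' : f * n ≤ 2 * a)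
    (hgk : g ^ k * n ≤ 1) (hqD : q ≤ (1 - f) ^ n * (1 - g) ^ D) (hb : 0 < b)
    (hbD : ∀ d : ℕ, (1 + 1 : ℝ) ^ d ≤ b → d ≤ D) (hDn : 4 * D ≤ n)
    (hzq : 4 * a ^ 2 + 2 * a ≤ 2 * z * (a * q / 8)) (hδ0 : 0 < δ) (hδ1 : δ ≤ 1)
    (hδ : δ ≤ a * q / 8 / (1 + z) ^ 2)
    (hG : IsEdgeMarkovian μ (edgeMatrix f g) G) (hχ : IsUniformContacts μ G χ) (v₀ : Fin n)
    (j : ℕ) :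
    μ.real {ω | informed pull χ v₀ ω (k + j + 1) ≠ Finset.univ} ≤
      n * ((1 - δ) ^ j * n + n ^ 2 * Real.exp (4 * a + 1) / b / δ) := by
  have hn0 : (0 : ℝ) < n := by exact_mod_cast (Fin.pos v₀)
  set η := n ^ 2 * Real.exp (4 * a + 1) / b with hη
  have hη0 : 0 ≤ η := by positivity
  have hIne : ∀ t ω, (informed pull χ v₀ ω t).Nonempty := fun t ω =>
    informed_pull_nonempty χ v₀ ω t
  have hΦn : ∀ I : Finset (Fin n), I.Nonempty → n / (I.card : ℝ) - 1 ≤ n := by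
    intro I hI
    have : (1 : ℝ) ≤ I.card := by exact_mod_cast hI.card_pos
    linarith [div_le_self hn0.le this]
  have hpoint : ∀ (H : SimpleGraph (Fin n)) (I : Finset (Fin n)), I.Nonempty →
      stepMean (edgeMatrix f g) (fun _ J => n / (J.card : ℝ) - 1) H I ≤
        (1 - δ) * (n / (I.card : ℝ) - 1) + ∑ v, n / b * (1 + 1) ^ H.degree v := by
    intro H I hI
    have hterm : ∀ v, 0 ≤ n / b * (1 + 1 : ℝ) ^ H.degree v := fun v => by positivity
    -- On a good graph all degrees are at most `D` and the contraction applies. On a bad one the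
    -- potential still does not increase in mean, and a single term of the error sum is at least
    -- `n`, which covers the missing `δ * (n / |I| - 1)`.
    by_cases hgood : ∀ v, (1 + 1 : ℝ) ^ H.degree v ≤ b
    · have h := stepMean_potential_le hf hg ha hq hz hfn hfn' H (fun v => hqD.trans
        (mul_le_mul_of_nonneg_left
          (pow_le_pow_of_le_one (by linarith [hg.2]) (by linarith [hg.1]) (hbD _ (hgood v)))
          (pow_nonneg (by linarith [hf.2]) _)))
        (fun v => hbD _ (hgood v)) hDn hzq hδ hI
      have := Finset.sum_nonneg fun v (_ : v ∈ Finset.univ) => hterm v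
      linarith
    · push Not at hgood
      obtain ⟨v, hv⟩ := hgood
      have h1 : stepMean (edgeMatrix f g) (fun _ J => n / (J.card : ℝ) - 1) H I ≤
          n / (I.card : ℝ) - 1 := by
        have hI0 : (0 : ℝ) < I.card := Nat.cast_pos.2 hI.card_pos
        refine (stepMean_le_graphMean hf hg (φ := fun x => n / x - 1) (fun x hx y _ hxy =>
          sub_le_sub_right (div_le_div_of_nonneg_left hn0.le hx hxy) 1) H hI).trans ?_
        calc _ ≤ graphMean (edgeMatrix f g) H (fun _ => n / (I.card : ℝ) - 1) := by
              refine graphMean_mono H hf hg fun H' => ?_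
              have := leafCount_nonneg H I H'
              exact sub_le_sub_right
                (div_le_div_of_nonneg_left hn0.le hI0 (by linarith)) 1
          _ = n / (I.card : ℝ) - 1 := by
              rw [graphMean, ← Finset.sum_mul, sum_graphTransition, one_mul]
      have h2 : n ≤ n / b * (1 + 1 : ℝ) ^ H.degree v := by
        rw [div_mul_eq_mul_div, le_div_iff₀ hb]
        gcongr
      have h3 := Finset.single_le_sum (fun v _ => hterm v) (Finset.mem_univ v)
      have h4 : δ * (n / (I.card : ℝ) - 1) ≤ n :=
        calc δ * (n / (I.card : ℝ) - 1) ≤ δ * n := by gcongr; exact hΦn I hI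
          _ ≤ 1 * n := by gcongr
          _ = n := one_mul _
      linarith
  -- The index is shifted because the graph at time `t` is paired with the set informed after `t +
  -- 1` rounds, those that used the graphs `0, …, t`.
  set e : ℕ → ℝ := fun t => ∫ ω, (n / ((informed pull χ v₀ ω (t + 1)).card : ℝ) - 1) ∂μ with he
  have hint := fun t F => integrable_graph_informed hG hχ v₀ F t
  have hrec : ∀ t, k ≤ t → e (t + 1) ≤ (1 - δ) * e t + η := by
    intro t ht
    have hgt : g ^ t * n ≤ 1 :=
      (mul_le_mul_of_nonneg_right (pow_le_pow_of_le_one hg.1 hg.2 ht) hn0.le).trans hgk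
    calc e (t + 1) = ∫ ω, stepMean (edgeMatrix f g) (fun _ J => n / (J.card : ℝ) - 1) (G t ω)
            (informed pull χ v₀ ω (t + 1)) ∂μ :=
          integral_graph_informed_succ hG hχ v₀ (fun _ J => n / (J.card : ℝ) - 1) t
      _ ≤ ∫ ω, ((1 - δ) * (n / ((informed pull χ v₀ ω (t + 1)).card : ℝ) - 1) +
            ∑ v, n / b * (1 + 1) ^ (G t ω).degree v) ∂μ :=
          integral_mono (hint t _) (hint t fun H I => (1 - δ) * (n / (I.card : ℝ) - 1) +
            ∑ v, n / b * (1 + 1) ^ H.degree v) fun ω => hpoint _ _ (hIne _ _)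
      _ = (1 - δ) * e t + ∑ v, n / b * ∫ ω, (1 + 1) ^ (G t ω).degree v ∂μ := by
          rw [integral_add (hint t fun _ I => (1 - δ) * (n / (I.card : ℝ) - 1))
            (hint t fun H _ => ∑ v, n / b * (1 + 1) ^ H.degree v), integral_const_mul,
            integral_finsetSum _ fun v _ => hint t fun H _ => n / b * (1 + 1) ^ H.degree v]
          simp_rw [integral_const_mul]
          rfl
      _ ≤ (1 - δ) * e t + ∑ _v : Fin n, n / b * Real.exp (4 * a + 1) := by
          gcongr with v
          refine (integral_pow_degree_le hf.1 hg.1 hg2 hG hχ v t zero_le_one).trans ?_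
          gcongr
          linarith
      _ = (1 - δ) * e t + η := by
          rw [Finset.sum_const, Finset.card_univ, Fintype.card_fin, nsmul_eq_mul, hη]
          ring
  have hbound : ∀ j, e (k + j) ≤ (1 - δ) ^ j * n + η / δ := by
    intro j
    -- `η / δ` is the fixed point of `s ↦ (1 - δ) * s + η`, and the initial excess is at most `n`.
    induction j with
    | zero =>
      have h1 : e k ≤ n := by
        calc e k ≤ ∫ _, (n : ℝ) ∂μ :=
              integral_mono (hint k fun _ I => n / (I.card : ℝ) - 1) (integrable_const _)
                fun ω => hΦn _ (hIne _ _)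
          _ = n := by simp
      have : 0 ≤ η / δ := by positivity
      simpa using h1.trans (by linarith)
    | succ j ih =>
      have h1 := hrec (k + j) (by omega)
      have h2 := mul_le_mul_of_nonneg_left ih (sub_nonneg.2 hδ1)
      have h3 : (1 - δ) * ((1 - δ) ^ j * n + η / δ) + η = (1 - δ) ^ (j + 1) * n + η / δ := by
        field_simp
        ring
      rw [← add_assoc]
      linarith
  have hmeas : MeasurableSet {ω | informed pull χ v₀ ω (k + j + 1) ≠ Finset.univ} := by
    have := measurable_comp_of_finite (measurableSet_graph_informed hG hχ v₀ (k + j))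
      (fun y => if y.2 = Finset.univ then (0 : ℕ) else 1)
    have h2 := this (measurableSet_singleton 1)
    convert h2 using 1
    ext ω
    simp
  -- Markov's inequality: if some vertex is uninformed, then `n / |I| - 1 = (n - |I|) / |I| ≥ 1 /
  -- n`.
  have hlow : μ.real {ω | informed pull χ v₀ ω (k + j + 1) ≠ Finset.univ} * (1 / n) ≤
      e (k + j) := by
    rw [← smul_eq_mul, ← setIntegral_const, ← integral_indicator hmeas]
    refine integral_mono ((integrable_const _).indicator hmeas)
      (hint (k + j) fun _ I => n / (I.card : ℝ) - 1) fun ω => ?_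
    set I := informed pull χ v₀ ω (k + j + 1) with hI
    have hI0 : (0 : ℝ) < I.card := Nat.cast_pos.2 (hIne _ _).card_pos
    have hle : I.card ≤ n := by simpa using Finset.card_le_univ I
    have hle' : (I.card : ℝ) ≤ n := Nat.cast_le.2 hle
    by_cases h : I = Finset.univ
    · rw [Set.indicator_of_notMem (by simpa using h)]
      change (0 : ℝ) ≤ n / (I.card : ℝ) - 1
      rw [sub_nonneg, le_div_iff₀ hI0]
      linarith
    · rw [Set.indicator_of_mem (by simpa using h)]
      change 1 / (n : ℝ) ≤ n / (I.card : ℝ) - 1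
      have hlt : I.card < n := by
        simpa using Finset.card_lt_univ_of_notMem
          (not_forall.1 (mt Finset.eq_univ_iff_forall.2 h)).choose_spec
      have hlt' : (I.card : ℝ) + 1 ≤ n := by exact_mod_cast hlt
      calc 1 / (n : ℝ) ≤ 1 / I.card := one_div_le_one_div_of_le hI0 hle'
        _ ≤ (n - I.card) / I.card := by
            gcongr
            linarith
        _ = n / (I.card : ℝ) - 1 := by field_simp
  have := hlow.trans (hbound j)
  rw [mul_one_div, div_le_iff₀ hn0] at this
  linarith

end PullDynamics

/-! ### Choice of the parameters for large `n` -/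

open Filter

/-- If the densities are of order `1 / n` and the survival probability of an edge is polynomially
small, then pull completes in logarithmic time. -/
theorem completesInBigOWhp_pull {f g : ℕ → ℝ} {a β : ℝ} (ha : 0 < a) (hβ : 0 < β)
    (hf : ∀ᶠ n in atTop, f n ∈ Set.Icc (0 : ℝ) 1) (hg : ∀ᶠ n in atTop, g n ∈ Set.Icc (0 : ℝ) 1)
    (hfn : ∀ᶠ n : ℕ in atTop, a / 2 ≤ f n * n ∧ f n * n ≤ 2 * a)
    (hgn : ∀ᶠ n : ℕ in atTop, g n ≤ (n : ℝ) ^ (-β)) :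
    CompletesInBigOWhp.{u} pull (fun n => edgeMatrix (f n) (g n)) (fun n => Real.log n) := by
  -- The exponential bounds `(1 - f) ^ n` from below, through `1 - f ≥ exp (-2 * f)` and `f * n ≤ 2
  -- * a`; the `1 / 2` comes from Bernoulli's inequality for `(1 - g) ^ D` with `D * g ≤ 1 / 2`.
  set q : ℝ := Real.exp (-(4 * a)) * (1 / 2) with hq
  have hq0 : 0 < q := by positivity
  set z : ℝ := (4 * a ^ 2 + 2 * a) / (2 * (a * q / 8)) with hz
  have hz0 : 0 ≤ z := by positivity
  set δ : ℝ := min 1 (a * q / 8 / (1 + z) ^ 2) with hδ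
  have hδ0 : 0 < δ := lt_min one_pos (by positivity)
  have hδ1 : δ ≤ 1 := min_le_left _ _
  -- From `g n ≤ n ^ (-β)` and `k ≥ 1 / β` follows `g n ^ k * n ≤ 1`: after `k` steps the initial
  -- graph is forgotten.
  set k : ℕ := ⌈1 / β⌉₊ with hk
  set K : ℝ := Real.exp (4 * a + 1) / δ with hK
  have hK0 : 0 ≤ K := by positivity
  have hlog : Tendsto (fun n : ℕ => Real.log n) atTop atTop :=
    Real.tendsto_log_atTop.comp tendsto_natCast_atTop_atTop
  have hlogpow : ∀ s : ℝ, 0 < s → ∀ ε : ℝ, 0 < ε →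
      ∀ᶠ n : ℕ in atTop, Real.log n ≤ ε * (n : ℝ) ^ s := by
    intro s hs ε hε
    have h := tendsto_natCast_atTop_atTop.eventually ((isLittleO_log_rpow_atTop hs).bound hε)
    filter_upwards [h, eventually_ge_atTop 1] with n hn hn1
    have h0 : (0 : ℝ) ≤ (n : ℝ) ^ s := by positivity
    rw [Real.norm_of_nonneg h0] at hn
    exact (le_abs_self _).trans hn
  have hsqrt : ∀ᶠ n : ℕ in atTop, 1 + K ≤ (n : ℝ) ^ (1 / 2 : ℝ) :=
    ((tendsto_rpow_atTop (by norm_num)).comp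
      tendsto_natCast_atTop_atTop).eventually_ge_atTop _
  have hbeta : ∀ᶠ n : ℕ in atTop, (2 : ℝ) ≤ (n : ℝ) ^ β :=
    ((tendsto_rpow_atTop hβ).comp tendsto_natCast_atTop_atTop).eventually_ge_atTop _
  obtain ⟨N, hN⟩ := eventually_atTop.1
    (hf.and <| hg.and <| hfn.and <| hgn.and <| hsqrt.and <| hbeta.and <|
      (hlogpow β hβ (1 / 16) (by norm_num)).and <|
      (hlogpow 1 one_pos (1 / 32) (by norm_num)).and <|
      (hlog.eventually_ge_atTop ((k : ℝ) + 2)).and <|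
      (eventually_ge_atTop (max 1 ⌈4 * a⌉₊)))
  -- The term `3 / δ` brings `(1 - δ) ^ j` below `n ^ (-3)`; the extra `log n` absorbs the `k + 1`
  -- additional rounds and the rounding. The exponent `1 / 2` leaves room for constants in a failure
  -- bound of order `1 / n`.
  refine ⟨3 / δ + 1, by positivity, 1 / 2, by norm_num, N, fun n hn Ω _ μ _ G χ v₀ hG hχ => ?_⟩
  obtain ⟨hf, hg, ⟨hfn1, hfn2⟩, hgn, hsqrt, hbeta, hlogβ, hlog1, hlogk, hmax⟩ := hN n hn
  have hn1 : (1 : ℝ) ≤ n := by exact_mod_cast (le_max_left _ _).trans hmax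
  have hn4a : 4 * a ≤ n :=
    (Nat.le_ceil _).trans (by exact_mod_cast (le_max_right _ _).trans hmax)
  have hn0 : (0 : ℝ) < n := by linarith only [hn1]
  have hl0 : 0 ≤ Real.log n := Real.log_nonneg hn1
  have hβ0 : (0 : ℝ) < (n : ℝ) ^ β := by positivity
  rw [Real.rpow_neg hn0.le] at hgn
  have hg2 : g n ≤ 1 / 2 := by
    rw [one_div]
    exact hgn.trans (inv_anti₀ two_pos hbeta)
  have hgk : g n ^ k * n ≤ 1 := by
    have h1 : (n : ℝ) ≤ ((n : ℝ) ^ β) ^ k := by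
      rw [← Real.rpow_natCast, ← Real.rpow_mul hn0.le]
      conv_lhs => rw [← Real.rpow_one (n : ℝ)]
      refine Real.rpow_le_rpow_of_exponent_le hn1 ?_
      have := Nat.le_ceil (1 / β)
      rwa [div_le_iff₀ hβ, mul_comm] at this
    calc g n ^ k * n ≤ (((n : ℝ) ^ β)⁻¹) ^ k * ((n : ℝ) ^ β) ^ k := by
          gcongr
          exact hg.1
      _ = 1 := by
          rw [← mul_pow, inv_mul_cancel₀ hβ0.ne', one_pow]
  have hD8 : (⌊8 * Real.log n⌋₊ : ℝ) ≤ 8 * Real.log n := Nat.floor_le (by positivity)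
  have hgD : ⌊8 * Real.log n⌋₊ * g n ≤ 1 / 2 :=
    calc ⌊8 * Real.log n⌋₊ * g n ≤ (8 * Real.log n) * ((n : ℝ) ^ β)⁻¹ := by
          gcongr
          exact hg.1
      _ ≤ (8 * (1 / 16 * (n : ℝ) ^ β)) * ((n : ℝ) ^ β)⁻¹ := by gcongr
      _ = 1 / 2 := by
          field_simp
          norm_num
  have hqD : q ≤ (1 - f n) ^ n * (1 - g n) ^ ⌊8 * Real.log n⌋₊ := by
    have hf2 : f n ≤ 1 / 2 := by
      by_contra h
      push Not at h
      nlinarith only [h, hfn2, hn4a, hn0]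
    have h1 : Real.exp (-(2 * f n)) ≤ 1 - f n := by
      have h3 := Real.add_one_le_exp (2 * f n)
      rw [Real.exp_neg, inv_le_comm₀ (Real.exp_pos _) (by linarith)]
      refine le_trans ?_ h3
      rw [inv_le_iff_one_le_mul₀ (by linarith)]
      nlinarith only [mul_nonneg hf.1 (sub_nonneg.2 hf2)]
    have h2 : Real.exp (-(4 * a)) ≤ (1 - f n) ^ n :=
      calc Real.exp (-(4 * a)) ≤ Real.exp (n * (-(2 * f n))) := by
            apply Real.exp_le_exp.2
            linarith
        _ = Real.exp (-(2 * f n)) ^ n := Real.exp_nat_mul _ _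
        _ ≤ _ := by gcongr
    have h3 : 1 / 2 ≤ (1 - g n) ^ ⌊8 * Real.log n⌋₊ := by
      have := one_add_mul_le_pow (a := -g n) (by linarith [hg.2]) ⌊8 * Real.log n⌋₊
      rw [← sub_eq_add_neg] at this
      linarith
    exact mul_le_mul h2 h3 (by norm_num) (pow_nonneg (by linarith [hf.2]) _)
  -- Here `b = n ^ 5` and `D = ⌊8 * log n⌋`: the constant `8` works since `5 / log 2 < 8`.
  have hbD : ∀ d : ℕ, (1 + 1 : ℝ) ^ d ≤ (n : ℝ) ^ 5 → d ≤ ⌊8 * Real.log n⌋₊ := by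
    intro d hd
    refine Nat.le_floor ?_
    have h := Real.log_le_log (by positivity) hd
    rw [Real.log_pow, Real.log_pow, one_add_one_eq_two] at h
    have := Real.log_two_gt_d9
    push_cast at h
    nlinarith [(Nat.cast_nonneg d : (0 : ℝ) ≤ d)]
  have hDn : 4 * ⌊8 * Real.log n⌋₊ ≤ n := by
    rw [Real.rpow_one] at hlog1
    have : 4 * (⌊8 * Real.log n⌋₊ : ℝ) ≤ n := by linarith
    exact_mod_cast this
  set T := ⌊(3 / δ + 1) * Real.log n⌋₊ with hT
  have hTle : (T : ℝ) ≤ (3 / δ + 1) * Real.log n := Nat.floor_le (by positivity)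
  have hTge : 3 / δ * Real.log n + (k + 1) ≤ T := by
    have := Nat.lt_floor_add_one ((3 / δ + 1) * Real.log n)
    rw [← hT] at this
    linarith
  obtain ⟨j, hj⟩ : ∃ j, T = k + j + 1 := by
    have : ((k + 1 : ℕ) : ℝ) ≤ T := by
      push_cast
      have : 0 ≤ 3 / δ * Real.log n := by positivity
      linarith
    have := Nat.cast_le.1 this
    exact ⟨T - (k + 1), by omega⟩
  have hjge : 3 / δ * Real.log n ≤ j := by
    rw [hj] at hTge
    push_cast at hTge
    linarith
  have hpow : (1 - δ) ^ j ≤ 1 / (n : ℝ) ^ 3 :=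
    calc (1 - δ) ^ j ≤ Real.exp (-δ) ^ j := by
          gcongr
          linarith [Real.add_one_le_exp (-δ)]
      _ = Real.exp (j * -δ) := (Real.exp_nat_mul _ _).symm
      _ ≤ Real.exp (-(3 * Real.log n)) := by
          apply Real.exp_le_exp.2
          have := mul_le_mul_of_nonneg_right hjge hδ0.le
          have e : 3 / δ * Real.log n * δ = 3 * Real.log n := by field_simp
          linarith
      _ = 1 / (n : ℝ) ^ 3 := by
          rw [Real.exp_neg, one_div]
          congr 1
          have := Real.exp_nat_mul (Real.log n) 3
          rw [Real.exp_log hn0] at this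
          exact_mod_cast this
  have hmain := measureReal_informed_ne_univ_le (μ := μ) (z := z) (δ := δ) (k := k) hf hg hg2 ha
    hq0 hz0 hfn1 hfn2 hgk hqD (by positivity : (0 : ℝ) < (n : ℝ) ^ 5) hbD hDn
    (le_of_eq (by rw [hz]; field_simp)) hδ0 hδ1 (min_le_right _ _) hG hχ v₀ j
  rw [← hj] at hmain
  have hfinal : μ.real {ω | informed pull χ v₀ ω T ≠ Finset.univ} ≤ (n : ℝ) ^ (-(1 / 2) : ℝ) :=
    calc _ ≤ n * (1 / (n : ℝ) ^ 3 * n + n ^ 2 * Real.exp (4 * a + 1) / n ^ 5 / δ) := by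
          refine hmain.trans ?_
          gcongr
      _ = (1 + K / n) * (n : ℝ)⁻¹ := by
          rw [hK]
          field_simp
      _ ≤ (1 + K) * (n : ℝ)⁻¹ := by
          gcongr
          exact div_le_self hK0 hn1
      _ ≤ (n : ℝ) ^ (1 / 2 : ℝ) * (n : ℝ)⁻¹ := by gcongr
      _ = (n : ℝ) ^ (-(1 / 2) : ℝ) := by
          rw [← Real.rpow_neg_one, ← Real.rpow_add hn0]
          norm_num
  calc μ {ω | ENNReal.ofReal ((3 / δ + 1) * Real.log n) < (completionTime pull χ v₀ ω : ℝ≥0∞)}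
      ≤ μ {ω | informed pull χ v₀ ω T ≠ Finset.univ} := by
        refine measure_mono fun ω hω hfull => ?_
        refine (not_le.2 (Set.mem_ofPred.1 hω)) ?_
        calc (completionTime pull χ v₀ ω : ℝ≥0∞) ≤ ((T : ℕ∞) : ℝ≥0∞) :=
              ENat.toENNReal_le.2 (completionTime_le hfull)
          _ = ENNReal.ofReal (T : ℝ) := by simp
          _ ≤ _ := ENNReal.ofReal_le_ofReal hTle
    _ = ENNReal.ofReal (μ.real {ω | informed pull χ v₀ ω T ≠ Finset.univ}) :=
        (ofReal_measureReal (measure_ne_top _ _)).symm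
    _ ≤ _ := ENNReal.ofReal_le_ofReal hfinal

/-! ### Stationarity and the conclusion -/

theorem IsStationaryDistribution.eq_mul {f g : ℝ} {π : Fin 2 → ℝ}
    (h : IsStationaryDistribution (edgeMatrix f g) π) : f = π 1 * (1 - (g - f)) := by
  have h1 : π 0 + π 1 = 1 := by simpa using h.1.2
  have h2 := congrFun h.2 1
  simp [Matrix.vecMul, dotProduct, edgeMatrix] at h2
  have h3 : π 0 = 1 - π 1 := by linarith
  rw [h3] at h2
  linarith

end RumorSpreading

theorem corollary3 (f g : ℕ → ℝ) (π : ℕ → Fin 2 → ℝ) (γ M α a : ℝ) (n₀ : ℕ)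
    (hγ : 0 ≤ γ) (hM : 0 < M) (hα : 0 < α) (ha : 0 < a)
    (hf : ∀ n ≥ n₀, f n ∈ Set.Icc (0 : ℝ) 1) (hg : ∀ n ≥ n₀, g n ∈ Set.Icc (0 : ℝ) 1)
    (hf_anti : AntitoneOn f (Set.Ici n₀)) (hg_anti : AntitoneOn g (Set.Ici n₀))
    (hf_lim : Filter.Tendsto f Filter.atTop (nhds γ))
    (hg_lim : Filter.Tendsto g Filter.atTop (nhds γ))
    (hfg : ∀ n ≥ n₀, |g n - f n| ≤ M / (n : ℝ) ^ α)
    (hπ : ∀ n ≥ n₀, RumorSpreading.IsStationaryDistribution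
      (RumorSpreading.edgeMatrix (f n) (g n)) (π n))
    (hπ_one : ∀ n ≥ n₀, π n 1 = a / (n : ℝ)) :
    RumorSpreading.CompletesInBigOWhp.{u} RumorSpreading.pull
        (fun n => RumorSpreading.edgeMatrix (f n) (g n)) (fun n => Real.log n) ∧
      RumorSpreading.CompletesInBigOWhp.{u} RumorSpreading.pushPull
        (fun n => RumorSpreading.edgeMatrix (f n) (g n)) (fun n => Real.log n) := by
  suffices h : RumorSpreading.CompletesInBigOWhp.{u} RumorSpreading.pull
      (fun n => RumorSpreading.edgeMatrix (f n) (g n)) (fun n => Real.log n) from ⟨h, h.pushPull⟩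
  -- Both `f n` and `|g n - f n|` are `O(n ^ (-2 * β))`; halving the exponent lets a factor `n ^ β`
  -- absorb the constant `2 * a + M`.
  set β : ℝ := min α 1 / 2 with hβ
  have hβ0 : 0 < β := by positivity
  have hβα : 2 * β ≤ α := by rw [hβ]; linarith [min_le_left α 1]
  have hβ1 : 2 * β ≤ 1 := by rw [hβ]; linarith [min_le_right α 1]
  have hlarge : ∀ s : ℝ, 0 < s → ∀ B : ℝ, ∀ᶠ n : ℕ in Filter.atTop,
      B ≤ (n : ℝ) ^ s := fun s hs B =>
    ((tendsto_rpow_atTop hs).comp tendsto_natCast_atTop_atTop).eventually_ge_atTop _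
  have hfn : ∀ᶠ n : ℕ in Filter.atTop, a / 2 ≤ f n * n ∧ f n * n ≤ 2 * a := by
    filter_upwards [Filter.eventually_ge_atTop n₀, Filter.eventually_ge_atTop 1,
      hlarge α hα (2 * M)] with n hn hn1 hnM
    have hn0 : (0 : ℝ) < n := by exact_mod_cast hn1
    have hd : |g n - f n| ≤ 1 / 2 := by
      refine (hfg n hn).trans ?_
      rw [div_le_iff₀ (by positivity)]
      linarith
    -- The balance equation with `π n 1 = a / n` fixes the scale of `f n`; since `|g n - f n| ≤ 1 /
    -- 2` the product lies between `a / 2` and `2 * a`.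
    have e : f n * n = a * (1 - (g n - f n)) := by
      conv_lhs => rw [(hπ n hn).eq_mul, hπ_one n hn]
      field_simp
    rw [e]
    obtain ⟨h1, h2⟩ := abs_le.1 hd
    constructor <;> nlinarith
  refine RumorSpreading.completesInBigOWhp_pull ha hβ0 (Filter.eventually_atTop.2 ⟨n₀, hf⟩)
    (Filter.eventually_atTop.2 ⟨n₀, hg⟩) hfn ?_
  filter_upwards [Filter.eventually_ge_atTop n₀, Filter.eventually_ge_atTop 1, hfn,
    hlarge β hβ0 (2 * a + M)] with n hn hn1 hfn hnβ
  have hn1' : (1 : ℝ) ≤ n := by exact_mod_cast hn1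
  have hn0 : (0 : ℝ) < n := by linarith
  have h1 : g n ≤ f n + M / (n : ℝ) ^ α := by
    linarith [(abs_le.1 (hfg n hn)).2]
  have h2 : f n ≤ 2 * a / (n : ℝ) ^ (2 * β) := by
    have h3 : (n : ℝ) ^ (2 * β) ≤ n := by
      conv_rhs => rw [← Real.rpow_one (n : ℝ)]
      exact Real.rpow_le_rpow_of_exponent_le hn1' hβ1
    rw [le_div_iff₀ (by positivity)]
    exact (mul_le_mul_of_nonneg_left h3 (hf n hn).1).trans hfn.2
  have h3 : M / (n : ℝ) ^ α ≤ M / (n : ℝ) ^ (2 * β) := by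
    gcongr
  calc g n ≤ (2 * a + M) / (n : ℝ) ^ (2 * β) := by
        rw [add_div]
        linarith
    _ ≤ (n : ℝ) ^ β / (n : ℝ) ^ (2 * β) := by gcongr
    _ = (n : ℝ) ^ (-β) := by
        rw [← Real.rpow_sub hn0]
        congr 1
        ring
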